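/- Fix real parameters $q,\mu,\nu$ with $|q|<1$, $0\le\nu\le\mu<1$, and integers $N,k\ge 1$. Write $(a;q)_n=\prod_{i=0}^{n-1}(1-aq^i)$ and $(a;q)_\infty=\prod_{i\ge0}(1-aq^i)$, and for integers $0\le j\le m$ let $$\varphi_{q,\mu,\nu}(j|m)=\mu^j\,\frac{(\nu/\mu;q)_j\,(\mu;q)_{m-j}}{(\nu;q)_m}\,\frac{(q;q)_m}{(q;q)_j(q;q)_{m-j}},\qquad \varphi_{q,\mu,\nu}(j|\infty)=\mu^j\,\frac{(\nu/\mu;q)_j\,(\mu;q)_\infty}{(\nu;q)_\infty}\,\frac1{(q;q)_j}$$ (for $\mu=\nu=0$ this is read as the point mass at $j=0$). The $N$-particle $(q,\mu,\nu)$-TASEP is the discrete time Markov chain $x(t)=(x_1(t)>\dots>x_N(t))$ on $\mathbb Z^N$, $t=0,1,2,\dots$, in which, with $x_0\equiv+\infty$, at each time step all particles jump in parallel and independently: $x_n(t+1)=x_n(t)+j_n$ with $j_n$ distributed as $\varphi_{q,\mu,\nu}(\,\cdot\,|\,x_{n-1}(t)-x_n(t)-1)$. Start it from step initial data $x_n(0)=-n$,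 $1\le n\le N$. Then for all integers $N\ge n_1\ge n_2\ge\dots\ge n_k\ge 0$ and all integers $t\ge0$ the random variable $\prod_{i=1}^k q^{x_{n_i}(t)+n_i}$ is integrable (where $q^{x_0(t)+0}:=0$), and $$\mathbb E\Big[\prod_{i=1}^k q^{x_{n_i}(t)+n_i}\Big]=\frac{(-1)^kq^{k(k-1)/2}}{(2\pi \mathrm i)^k}\oint_{\gamma_1}\!\!\cdots\oint_{\gamma_k}\ \prod_{1\le A<B\le k}\frac{z_A-z_B}{z_A-qz_B}\ \prod_{j=1}^k\Big(\frac{1-\nu z_j}{1-z_j}\Big)^{n_j}\Big(\frac{1-\mu z_j}{1-\nu z_j}\Big)^{t}\frac{dz_j}{z_j(1-\nu z_j)}$$ for any closed piecewise $C^1$ contours $\gamma_1,\dots,\gamma_k$ in $\mathbb C$ such that every $\gamma_A$ contains $1$, $\gamma_A$ contains every point of $q\gamma_B$ whenever $A<B$, and every $\gamma_A$ excludes $0$ and (if $\nu\neq0$) $1/\nu$. Here a contour contains (respectively excludes) a point if it does not pass through the point and has winding number $1$ (respectively $0$) around it. -/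

import Mathlib

open MeasureTheory

noncomputable section

namespace QTasep

/-! ### The jump distribution -/

/-- The finite `q`-Pochhammer symbol `(a;q)_n = ∏_{i=0}^{n-1} (1 - a q^i)`. -/
def qPoch (a q : ℝ) (n : ℕ) : ℝ := ∏ i ∈ Finset.range n, (1 - a * q ^ i)

/-- The infinite `q`-Pochhammer symbol `(a;q)_∞ = ∏_{i=0}^∞ (1 - a q^i)`. -/
def qPochInf (a q : ℝ) : ℝ := ∏' i : ℕ, (1 - a * q ^ i)

/-- The weight `φ_{q,μ,ν}(j|m)`, for `m ∈ {0,1,2,…} ∪ {+∞}`; it is `0` for `j > m`.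
When `μ = ν = 0` the convention `0 / 0 = 0` makes `φ(·|m)` the point mass at `0`, which is
also the limit of the formula. -/
def jumpProb (q μ ν : ℝ) (j : ℕ) : ℕ∞ → ℝ
  | ⊤ => μ ^ j * (qPoch (ν / μ) q j * qPochInf μ q / qPochInf ν q) * (1 / qPoch q q j)
  | (m : ℕ) =>
    if j ≤ m then
      μ ^ j * (qPoch (ν / μ) q j * qPoch μ q (m - j) / qPoch ν q m) *
        (qPoch q q m / (qPoch q q j * qPoch q q (m - j)))
    else 0

/-! ### The `(q,μ,ν)`-TASEP -/

/-- Configurations `x_1 > x_2 > ⋯ > x_N` of `N` particles on `ℤ`. The index `i : Fin N` stands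
for the particle number `i + 1`; the virtual particle `x_0 = +∞` is left implicit. -/
abbrev Config (N : ℕ) : Type := {x : Fin N → ℤ // StrictAnti x}

/-- Step initial data, `x_n = -n` for `1 ≤ n ≤ N`. -/
def stepConfig (N : ℕ) : Config N :=
  ⟨fun i => -((i : ℤ) + 1), fun i j h => by
    have h' : (i : ℕ) < (j : ℕ) := h
    show -(((j : ℕ) : ℤ) + 1) < -(((i : ℕ) : ℤ) + 1)
    omega⟩

/-- The number `x_{n-1} - x_n - 1` of free sites in front of a particle; it is `+∞` for the
first particle. -/
def gap {N : ℕ} (x : Config N) (i : Fin N) : ℕ∞ :=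
  if (i : ℕ) = 0 then ⊤
  else ((x.1 ⟨(i : ℕ) - 1, lt_of_le_of_lt (Nat.sub_le _ _) i.isLt⟩ - x.1 i - 1).toNat : ℕ∞)

/-- The one-step transition probability from `x` to `y`: all particles jump in parallel and
independently, the `n`-th one by `y_n - x_n`, distributed as `φ(·|x_{n-1} - x_n - 1)`. -/
def transProb (q μ ν : ℝ) {N : ℕ} (x y : Config N) : ℝ :=
  ∏ i : Fin N, if x.1 i ≤ y.1 i then jumpProb q μ ν (y.1 i - x.1 i).toNat (gap x i) else 0

/-- `X` is, under `P`, an `N`-particle `(q,μ,ν)`-TASEP with step initial data: the discrete time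
Markov chain on the countable set `Config N` that starts at `stepConfig N` and has the transition
probabilities `transProb`. -/
structure IsStepTASEP (q μ ν : ℝ) (N : ℕ) {Ω : Type*} [MeasurableSpace Ω] (P : Measure Ω)
    (X : ℕ → Ω → Config N) : Prop where
  measurable : ∀ t, Measurable (X t)
  init : ∀ᵐ ω ∂P, X 0 ω = stepConfig N
  markov : ∀ (t : ℕ) (a : ℕ → Config N),
    P.real {ω | ∀ s ≤ t + 1, X s ω = a s} =
      P.real {ω | ∀ s ≤ t, X s ω = a s} * transProb q μ ν (a t) (a (t + 1))

/-- The observable `q^{x_n + n}` for `0 ≤ n ≤ N`; it is `0` for `n = 0`, as `x_0 = +∞`. -/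
def qObs (q : ℝ) {N : ℕ} (x : Config N) : Fin (N + 1) → ℝ :=
  Fin.cons 0 fun i : Fin N => q ^ (x.1 i + ((i : ℤ) + 1))

/-! ### Contours and contour integrals -/

/-- A closed path in `ℂ` is piecewise `C¹` if `[0,1]` can be cut at finitely many points such that
the path is `C¹` on each of the closed pieces. -/
def PiecewiseC1 {c : ℂ} (γ : Path c c) : Prop :=
  ∃ S : Finset ℝ, ∀ a b : ℝ, 0 ≤ a → a < b → b ≤ 1 →
    (∀ s ∈ S, s ∉ Set.Ioo a b) → ContDiffOn ℝ 1 γ.extend (Set.Icc a b)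

/-- A contour: a closed, piecewise `C¹` curve in `ℂ`. -/
structure Contour where
  base : ℂ
  path : Path base base
  piecewiseC1 : PiecewiseC1 path

/-- The trace of a contour. -/
def Contour.trace (γ : Contour) : Set ℂ := Set.range γ.path

/-- The contour integral `∮_γ f(z) dz`. -/
def contourIntegral (γ : Contour) (f : ℂ → ℂ) : ℂ :=
  curveIntegral (fun z => f z • (1 : ℂ →L[ℂ] ℂ)) γ.path

/-- The winding number `(2πi)⁻¹ ∮_γ dz / (z - w)` (for `w` off the contour). -/
def Contour.winding (γ : Contour) (w : ℂ) : ℂ :=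
  (2 * Real.pi * Complex.I)⁻¹ * contourIntegral γ fun z => (z - w)⁻¹

/-- The contour contains `w`: it avoids `w` and winds around it once, counterclockwise. For
a positively oriented simple closed curve this says that `w` lies in the interior. -/
def Contour.Contains (γ : Contour) (w : ℂ) : Prop := w ∉ γ.trace ∧ γ.winding w = 1

/-- The contour excludes `w`: it avoids `w` and does not wind around it. For a simple closed curve
this says that `w` lies in the exterior. -/
def Contour.Excludes (γ : Contour) (w : ℂ) : Prop := w ∉ γ.trace ∧ γ.winding w = 0

/-- Admissible contours `γ_1, …, γ_k`: all contain `1`, `γ_A` contains `q γ_B` for `A < B`, and all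
exclude `0` and `1 / ν` (where `1 / ν = ∞` is no condition if `ν = 0`). -/
structure Nested (q ν : ℝ) {k : ℕ} (γ : Fin k → Contour) : Prop where
  contains_one : ∀ A, (γ A).Contains 1
  contains_smul : ∀ A B, A < B → ∀ w ∈ (γ B).trace, (γ A).Contains ((q : ℂ) * w)
  excludes_zero : ∀ A, (γ A).Excludes 0
  excludes_inv : ν ≠ 0 → ∀ A, (γ A).Excludes (1 / (ν : ℂ))

/-- The iterated integral `∮_{γ_1} ⋯ ∮_{γ_k} F(z_1, …, z_k) dz_k ⋯ dz_1`. -/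
def iteratedIntegral : {k : ℕ} → (Fin k → Contour) → ((Fin k → ℂ) → ℂ) → ℂ
  | 0, _, F => F Fin.elim0
  | _ + 1, γ, F =>
    contourIntegral (γ 0) fun z =>
      iteratedIntegral (fun i => γ i.succ) fun w => F (Fin.cons z w)

/-- The integrand `∏_{A<B} (z_A - z_B)/(z_A - q z_B) ·
∏_j ((1-νz_j)/(1-z_j))^{n_j} ((1-μz_j)/(1-νz_j))^t / (z_j (1-νz_j))`. -/
def integrand (q μ ν : ℝ) (t : ℕ) {k : ℕ} (n : Fin k → ℕ) (z : Fin k → ℂ) : ℂ :=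
  (∏ A : Fin k, ∏ B ∈ Finset.Ioi A, (z A - z B) / (z A - q * z B)) *
    ∏ j : Fin k, ((1 - ν * z j) / (1 - z j)) ^ n j * ((1 - μ * z j) / (1 - ν * z j)) ^ t *
      (1 / (z j * (1 - ν * z j)))

end QTasep

end

/-!
The idea is Markov duality with the `(q,μ,ν)`-Boson process, solved by the coordinate Bethe ansatz.

Write a weakly decreasing list `n_1 ≥ ⋯ ≥ n_k` as clusters: `y_m` entries are equal to `m`. Given
`x(t)`, the jumps are independent, so the conditional expectation of `∏ q^{x_{n_i}(t+1)+n_i}` is a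
product over `m` of `q`-moments of `φ(·|gap)` of order `y_m`. The `q`-Hahn weights are self-dual,
`∑_j φ(j|m) q^{jy} = ∑_j φ(j|y) q^{jm}` (`hahnMoment_symm`; for an infinite gap this is the
`q`-binomial theorem, `hasSum_jumpProb_top`), and the right side says that `s` of the `y_m` entries
move from `m` to `m - 1` with probability `φ(s|y_m)`. Hence the expectations, as functions of the
list, evolve by the Boson process (`tsum_transProb_heightObs`, `IsStepTASEP.expObs_succ`). As the
observable with index `0` is zero, they vanish on lists with last entry `0`, and they are equal to
`1` at time zero on lists of positive entries; this determines them.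

The nested contour integrals solve the same problem. In the integrand each variable evolves by
itself, as a particle that drops by one with probability `(μ-ν)/(1-ν)` (`single_evolution`). The
free evolution agrees with the Boson process on functions `V` that satisfy a two-body boundary
condition relating `V(…,m,m,…)`, `V(…,m,m-1,…)`, `V(…,m-1,m,…)` and `V(…,m-1,m-1,…)`. Indeed, that
condition is a quadratic relation between the two operators that fix a coordinate to `m - 1` or to
`m`, and for generators `a`, `b` with this relation `((μ-ν)/(1-ν) a + (1-μ)/(1-ν) b)^y` expands as
`∑_s φ(s|y) a^s b^{y-s}` (`quadratic_sum`, `freeStep_clusterList`).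

For the integrals, the boundary condition holds because the combination multiplies the integrand
by a multiple of `z_i - q z_{i+1}`. This cancels the only pole that separates the two contours; they
can then be made equal, and the integrand is antisymmetric (`Nested.nestedIntegral_boundary`). If
`n_k = 0`, the integrand has no pole inside `γ_k`, so the integral is zero
(`Nested.nestedIntegral_single_zero`). At time zero the variables are integrated out beginning with
`z_1`, whose only pole outside `γ_1` is `0`, and the residues multiply to `1`
(`Nested.nestedSol_initial`).

All integrands are rational in each variable, so Cauchy's theorem is needed only for rational
functions, where it follows from partial fractions and primitives (`contourIntegral_eq_zero`,
`contourIntegral_eq_of_winding`, `contourIntegral_div_mul_linProd`). That `γ_B` does not wind about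
the points of `q⁻¹ γ_A` for `A < B` is not among the hypotheses; it follows from them by
`Contour.excludes_div`. To integrate the variables in any order, the iterated integrals are written
as integrals over a cube of parameters (`iteratedIntegral_eq_multiIntegral`).
-/


noncomputable section

namespace QTasep

/-! ### The `q`-Hahn weights -/

theorem qPoch_succ (a q : ℝ) (n : ℕ) : qPoch a q (n + 1) = qPoch a q n * (1 - a * q ^ n) :=
  Finset.prod_range_succ _ _

@[simp] theorem qPoch_zero (a q : ℝ) : qPoch a q 0 = 1 := Finset.prod_range_zero _

theorem one_sub_mul_pow_pos {a q : ℝ} (ha : |a| < 1) (hq : |q| < 1) (n : ℕ) :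
    0 < 1 - a * q ^ n := by
  have h1 : |a * q ^ n| < 1 := by
    rw [abs_mul, abs_pow]
    calc |a| * |q| ^ n ≤ |a| * 1 := by gcongr; exact pow_le_one₀ (abs_nonneg _) hq.le
      _ < 1 := by linarith
  linarith [le_abs_self (a * q ^ n)]

theorem one_sub_mul_pow_ne_zero {a q : ℝ} (ha : |a| < 1) (hq : |q| < 1) (n : ℕ) :
    1 - a * q ^ n ≠ 0 := (one_sub_mul_pow_pos ha hq n).ne'

theorem qPoch_ne_zero {a q : ℝ} (ha : |a| < 1) (hq : |q| < 1) (n : ℕ) : qPoch a q n ≠ 0 :=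
  Finset.prod_ne_zero_iff.2 fun i _ => one_sub_mul_pow_ne_zero ha hq i

/-- The weight `φ_{q,μ,ν}(j|m)` for finite `m`, with `μ^j (ν/μ;q)_j` written as the polynomial
`∏_{i<j} (μ - ν q^i)`, so that nothing special happens at `μ = 0`. -/
def hahn (q μ ν : ℝ) (m j : ℕ) : ℝ :=
  if j ≤ m then
    (∏ i ∈ Finset.range j, (μ - ν * q ^ i)) * qPoch μ q (m - j) / qPoch ν q m *
      (qPoch q q m / (qPoch q q j * qPoch q q (m - j)))
  else 0

theorem pow_mul_qPoch_div {q μ ν : ℝ} (h0 : μ = 0 → ν = 0) (j : ℕ) :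
    μ ^ j * qPoch (ν / μ) q j = ∏ i ∈ Finset.range j, (μ - ν * q ^ i) := by
  rcases eq_or_ne μ 0 with rfl | hμ
  · simp [h0 rfl, qPoch]
  · rw [qPoch, ← Finset.card_range j, ← Finset.prod_const, Finset.card_range,
      ← Finset.prod_mul_distrib]
    refine Finset.prod_congr rfl fun i _ => ?_
    field_simp

theorem jumpProb_natCast {q μ ν : ℝ} (h0 : μ = 0 → ν = 0) (m j : ℕ) :
    jumpProb q μ ν j (m : ℕ∞) = hahn q μ ν m j := by
  have h : jumpProb q μ ν j (m : ℕ∞) = if j ≤ m then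
      μ ^ j * (qPoch (ν / μ) q j * qPoch μ q (m - j) / qPoch ν q m) *
        (qPoch q q m / (qPoch q q j * qPoch q q (m - j)))
    else 0 := rfl
  rw [h, hahn, ← pow_mul_qPoch_div h0]
  split_ifs
  · ring
  · rfl

theorem hahn_of_lt {q μ ν : ℝ} {m j : ℕ} (h : m < j) : hahn q μ ν m j = 0 :=
  if_neg h.not_ge

theorem hahn_add (q μ ν : ℝ) (j r : ℕ) : hahn q μ ν (j + r) j =
    (∏ i ∈ Finset.range j, (μ - ν * q ^ i)) * qPoch μ q r / qPoch ν q (j + r) *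
      (qPoch q q (j + r) / (qPoch q q j * qPoch q q r)) := by
  simp [hahn]

section Recurrences

variable {q μ ν : ℝ} (hq : |q| < 1) (hν : |ν| < 1)
include hq hν

omit hν in
theorem hahn_zero_right (m : ℕ) : hahn q μ ν m 0 = qPoch μ q m / qPoch ν q m := by
  have := qPoch_ne_zero hq hq m
  simp [hahn, this]

theorem hahn_succ_succ (m j : ℕ) :
    (1 - q ^ (j + 1)) * hahn q μ ν (m + 1) (j + 1) * (1 - ν * q ^ m) =
      (1 - q ^ (m + 1)) * hahn q μ ν m j * (μ - ν * q ^ j) := by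
  rcases le_or_gt j m with h | h
  · obtain ⟨r, rfl⟩ := Nat.exists_eq_add_of_le h
    have e : j + r + 1 = (j + 1) + r := by ring
    have h1 := qPoch_ne_zero hq hq j
    have h2 := qPoch_ne_zero hq hq r
    have h3 := qPoch_ne_zero hν hq (j + r)
    have h4 := one_sub_mul_pow_ne_zero hν hq (j + r)
    have h5 := one_sub_mul_pow_ne_zero hq hq j
    rw [e, hahn_add, hahn_add, ← e, qPoch_succ, qPoch_succ, qPoch_succ, Finset.prod_range_succ,
      pow_succ' q j, pow_succ' q (j + r)]
    generalize 1 - q * q ^ j = D at *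
    field_simp
  · rw [hahn_of_lt h, hahn_of_lt (by omega)]; ring

theorem hahn_succ_left {m j : ℕ} (h : j ≤ m) :
    (1 - q ^ (m + 1 - j)) * hahn q μ ν (m + 1) j * (1 - ν * q ^ m) =
      (1 - q ^ (m + 1)) * hahn q μ ν m j * (1 - μ * q ^ (m - j)) := by
  obtain ⟨r, rfl⟩ := Nat.exists_eq_add_of_le h
  have e : j + r + 1 = j + (r + 1) := by ring
  have h1 := qPoch_ne_zero hq hq j
  have h2 := qPoch_ne_zero hq hq r
  have h3 := qPoch_ne_zero hν hq (j + r)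
  have h4 := one_sub_mul_pow_ne_zero hν hq (j + r)
  have h5 := one_sub_mul_pow_ne_zero hq hq r
  have e2 : j + (r + 1) - j = r + 1 := by omega
  have e3 : j + r - j = r := by omega
  rw [e, hahn_add, hahn_add, ← e, qPoch_succ, qPoch_succ, qPoch_succ, qPoch_succ, e, e2, e3,
    pow_succ' q r, ← e, pow_succ' q (j + r)]
  generalize 1 - q * q ^ r = D at *
  field_simp

theorem hahn_succ_right {m s : ℕ} (h : s + 1 ≤ m) :
    hahn q μ ν m (s + 1) * (1 - q ^ (s + 1)) * (1 - μ * q ^ (m - (s + 1))) =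
      hahn q μ ν m s * (1 - q ^ (m - s)) * (μ - ν * q ^ s) := by
  obtain ⟨r, rfl⟩ := Nat.exists_eq_add_of_le h
  have e : s + 1 + r = s + (r + 1) := by ring
  have h1 := qPoch_ne_zero hq hq s
  have h2 := qPoch_ne_zero hq hq r
  have h3 := qPoch_ne_zero hν hq (s + (r + 1))
  have h4 := one_sub_mul_pow_ne_zero hq hq s
  have h5 := one_sub_mul_pow_ne_zero hq hq r
  have e2 : s + (r + 1) - s = r + 1 := by omega
  have e3 : s + (r + 1) - (s + 1) = r := by omega
  rw [hahn_add, e, hahn_add, qPoch_succ, qPoch_succ, qPoch_succ, Finset.prod_range_succ, e2, e3,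
    pow_succ' q r, pow_succ' q s]
  generalize 1 - q * q ^ r = D at *
  generalize 1 - q * q ^ s = D' at *
  field_simp

/-- The weights `φ(·|m+1)` arise from `φ(·|m)` by one more draw from a `q`-Pólya urn. -/
theorem hahn_step {m j : ℕ} (h : j ≤ m) :
    (1 - ν * q ^ m) * hahn q μ ν (m + 1) (j + 1) =
      hahn q μ ν m (j + 1) * (1 - μ * q ^ (m - (j + 1))) +
        hahn q μ ν m j * (μ - ν * q ^ j) * q ^ (m - j) := by
  have ha := hahn_succ_succ (μ := μ) hq hν m j
  have hm : (1 : ℝ) - q ^ (m + 1) ≠ 0 := by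
    have := one_sub_mul_pow_ne_zero hq hq m
    rwa [← pow_succ'] at this
  rcases eq_or_lt_of_le h with rfl | h
  · rw [hahn_of_lt (m := j) (by omega)]
    apply mul_left_cancel₀ hm
    simp only [Nat.sub_self, pow_zero]
    linear_combination ha
  · have hb := hahn_succ_left (μ := μ) hq hν (m := m) (j := j + 1) h
    rw [show m + 1 - (j + 1) = m - j by omega] at hb
    apply mul_left_cancel₀ hm
    have e : q ^ (m + 1) = q ^ (m - j) * q ^ (j + 1) := by
      rw [← pow_add]; congr 1; omega
    linear_combination hb + q ^ (m - j) * ha - (1 - ν * q ^ m) * hahn q μ ν (m + 1) (j + 1) * e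

theorem hahn_step_zero (m : ℕ) :
    (1 - ν * q ^ m) * hahn q μ ν (m + 1) 0 = hahn q μ ν m 0 * (1 - μ * q ^ m) := by
  have h3 := qPoch_ne_zero hν hq m
  have h4 := one_sub_mul_pow_ne_zero hν hq m
  rw [hahn_zero_right hq, hahn_zero_right hq, qPoch_succ, qPoch_succ]
  field_simp

omit hq hν in
/-- The `q`-moment `∑_j φ(j|m) q^{jy}` of the weights. -/
def hahnMoment (q μ ν : ℝ) (m y : ℕ) : ℝ := ∑ j ∈ Finset.range (m + 1), hahn q μ ν m j * q ^ (j * y)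

/-- Summing a function of `j` against `φ(j|m+1)`, one draw at a time. -/
theorem sum_hahn_succ {M : Type*} [AddCommGroup M] [Module ℝ M] (m : ℕ) (f : ℕ → M) :
    (1 - ν * q ^ m) • ∑ j ∈ Finset.range (m + 2), hahn q μ ν (m + 1) j • f j =
      ∑ j ∈ Finset.range (m + 1), hahn q μ ν m j •
        ((1 - μ * q ^ (m - j)) • f j + ((μ - ν * q ^ j) * q ^ (m - j)) • f (j + 1)) := by
  have h1 : ∑ j ∈ Finset.range (m + 1), hahn q μ ν m j • ((1 - μ * q ^ (m - j)) • f j) =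
      hahn q μ ν m 0 • ((1 - μ * q ^ m) • f 0) + ∑ j ∈ Finset.range (m + 1),
        hahn q μ ν m (j + 1) • ((1 - μ * q ^ (m - (j + 1))) • f (j + 1)) := by
    rw [Finset.sum_range_succ' _ m, Finset.sum_range_succ _ m,
      hahn_of_lt (m := m) (j := m + 1) (by omega), zero_smul, add_zero, add_comm]
    simp
  simp only [smul_add, Finset.sum_add_distrib]
  rw [h1, Finset.sum_range_succ' _ (m + 1), smul_add, add_comm, smul_smul, hahn_step_zero hq hν,
    ← smul_smul, add_assoc, ← Finset.sum_add_distrib, Finset.smul_sum]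
  congr 1
  refine Finset.sum_congr rfl fun j hj => ?_
  rw [smul_smul, hahn_step hq hν (by simpa [Nat.lt_succ_iff] using hj), add_smul, smul_smul,
    smul_smul, mul_assoc]

omit hq hν in
theorem hahnMoment_zero_left (y : ℕ) : hahnMoment q μ ν 0 y = 1 := by
  simp [hahnMoment, hahn]

theorem hahnMoment_zero_right (m : ℕ) : hahnMoment q μ ν m 0 = 1 := by
  induction m with
  | zero => exact hahnMoment_zero_left 0
  | succ m ih =>
    have h := sum_hahn_succ (μ := μ) hq hν m (fun _ => (1 : ℝ))
    have h4 := one_sub_mul_pow_ne_zero hν hq m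
    apply mul_left_cancel₀ h4
    simp only [hahnMoment, mul_zero, pow_zero, mul_one, smul_eq_mul] at h ih ⊢
    rw [h, ← mul_one (1 - ν * q ^ m), ← ih, Finset.mul_sum]
    refine Finset.sum_congr rfl fun j hj => ?_
    have e : q ^ m = q ^ (m - j) * q ^ j := by
      rw [← pow_add]; congr 1; have := Finset.mem_range.1 hj; omega
    rw [e]; ring

theorem hahnMoment_succ_succ (m y : ℕ) :
    (1 - ν * q ^ m) * hahnMoment q μ ν (m + 1) (y + 1) =
      (1 - ν * q ^ (m + y + 1)) * hahnMoment q μ ν m (y + 1) -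
        μ * q ^ m * (1 - q ^ (y + 1)) * hahnMoment q μ ν m y := by
  have h := sum_hahn_succ (μ := μ) hq hν m (fun j => q ^ (j * (y + 1)))
  simp only [smul_eq_mul] at h
  rw [hahnMoment, h, hahnMoment, hahnMoment, Finset.mul_sum, Finset.mul_sum,
    ← Finset.sum_sub_distrib]
  refine Finset.sum_congr rfl fun j hj => ?_
  have e : q ^ m = q ^ (m - j) * q ^ j := by
    rw [← pow_add]; congr 1; have := Finset.mem_range.1 hj; omega
  rw [show m + y + 1 = m + (y + 1) by ring, pow_add, e]
  ring

theorem hahnMoment_sub (m y : ℕ) :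
    (1 - ν * q ^ m) * (hahnMoment q μ ν (m + 1) y - hahnMoment q μ ν (m + 1) (y + 1)) =
      (1 - q ^ (m + 1)) * q ^ y *
        (μ * hahnMoment q μ ν m y - ν * hahnMoment q μ ν m (y + 1)) := by
  simp only [hahnMoment]
  rw [← Finset.sum_sub_distrib, Finset.sum_range_succ' _ (m + 1)]
  simp only [zero_mul, pow_zero, mul_one, sub_self, add_zero, Finset.mul_sum]
  rw [← Finset.sum_sub_distrib, Finset.mul_sum]
  refine Finset.sum_congr rfl fun j _ => ?_
  have ha := hahn_succ_succ (μ := μ) hq hν m j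
  simp only [add_mul, mul_add, pow_add, mul_one, one_mul, pow_one] at ha ⊢
  linear_combination q ^ (j * y) * q ^ y * ha

/-- A recurrence that involves neither `μ` nor `ν`; with `hahnMoment_succ_succ` it gives
`hahnMoment_sub` with the two arguments exchanged. -/
theorem hahnMoment_contiguous (m y : ℕ) :
    q ^ y * (q ^ (m + 1) - 1) * hahnMoment q μ ν m (y + 1) +
      (q ^ y - q ^ m) * hahnMoment q μ ν (m + 1) (y + 1) +
      q ^ m * (1 - q ^ (y + 1)) * hahnMoment q μ ν (m + 1) y = 0 := by
  have h4 := one_sub_mul_pow_ne_zero hν hq m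
  -- the two ways of removing one draw, applied to `q^y (q^j - q^{m+1})` and `q^m (1 - q^j)`
  have hb : (1 - ν * q ^ m) * ∑ j ∈ Finset.range (m + 2),
      hahn q μ ν (m + 1) j * q ^ (j * y) * (q ^ y * (q ^ j - q ^ (m + 1))) =
      (1 - q ^ (m + 1)) * ∑ j ∈ Finset.range (m + 1),
        hahn q μ ν m j * q ^ (j * y) * (q ^ y * q ^ j * (1 - μ * q ^ (m - j))) := by
    rw [Finset.sum_range_succ, sub_self, mul_zero, mul_zero, add_zero, Finset.mul_sum,
      Finset.mul_sum]
    refine Finset.sum_congr rfl fun j hj => ?_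
    have hjm : j ≤ m := by simpa [Nat.lt_succ_iff] using hj
    have hb := hahn_succ_left (μ := μ) hq hν hjm
    have e : q ^ (m + 1) = q ^ (m + 1 - j) * q ^ j := by
      rw [← pow_add]; congr 1; omega
    rw [e] at hb ⊢
    linear_combination q ^ (j * y) * q ^ y * q ^ j * hb
  have ha : (1 - ν * q ^ m) * ∑ j ∈ Finset.range (m + 2),
      hahn q μ ν (m + 1) j * q ^ (j * y) * (q ^ m * (1 - q ^ j)) =
      (1 - q ^ (m + 1)) * ∑ j ∈ Finset.range (m + 1),
        hahn q μ ν m j * q ^ (j * y) * (q ^ m * q ^ y * (μ - ν * q ^ j)) := by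
    rw [Finset.sum_range_succ', pow_zero, sub_self, mul_zero, mul_zero, add_zero, Finset.mul_sum,
      Finset.mul_sum]
    refine Finset.sum_congr rfl fun j _ => ?_
    have ha := hahn_succ_succ (μ := μ) hq hν m j
    rw [add_mul, one_mul, pow_add]
    linear_combination q ^ (j * y) * q ^ y * q ^ m * ha
  apply mul_left_cancel₀ h4
  have hl : (q ^ y - q ^ m) * hahnMoment q μ ν (m + 1) (y + 1) +
      q ^ m * (1 - q ^ (y + 1)) * hahnMoment q μ ν (m + 1) y =
      ∑ j ∈ Finset.range (m + 2),
        hahn q μ ν (m + 1) j * q ^ (j * y) * (q ^ y * (q ^ j - q ^ (m + 1))) +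
      ∑ j ∈ Finset.range (m + 2),
        hahn q μ ν (m + 1) j * q ^ (j * y) * (q ^ m * (1 - q ^ j)) := by
    simp only [hahnMoment]
    rw [Finset.mul_sum, Finset.mul_sum, ← Finset.sum_add_distrib, ← Finset.sum_add_distrib]
    refine Finset.sum_congr rfl fun j _ => ?_
    rw [mul_add, mul_one, pow_add]
    ring
  rw [mul_zero, add_assoc, hl, mul_add, mul_add, hb, ha, ← mul_add, ← Finset.sum_add_distrib,
    hahnMoment, Finset.mul_sum, Finset.mul_sum, Finset.mul_sum, ← Finset.sum_add_distrib]
  refine Finset.sum_eq_zero fun j hj => ?_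
  have e : q ^ m = q ^ (m - j) * q ^ j := by
    rw [← pow_add]; congr 1; have := Finset.mem_range.1 hj; omega
  rw [mul_add, mul_one, pow_add, pow_succ, e]
  ring

/-- The self-duality `∑_j φ(j|m) q^{jy} = ∑_j φ(j|y) q^{jm}`. -/
theorem hahnMoment_symm (m y : ℕ) : hahnMoment q μ ν m y = hahnMoment q μ ν y m := by
  induction m generalizing y with
  | zero => rw [hahnMoment_zero_left, hahnMoment_zero_right hq hν]
  | succ m ihm =>
    induction y with
    | zero => rw [hahnMoment_zero_left, hahnMoment_zero_right hq hν]
    | succ y ihy =>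
      have h1 := hahnMoment_sub (μ := μ) hq hν m y
      have h2 := hahnMoment_succ_succ (μ := μ) hq hν y m
      have h3 := hahnMoment_contiguous (μ := μ) hq hν y m
      have h4 := one_sub_mul_pow_ne_zero hν hq m
      rw [ihm, ihm, ihy] at h1
      apply mul_left_cancel₀ h4
      rw [show y + m + 1 = y + (m + 1) by ring, pow_add] at h2
      linear_combination -h1 - h2 + ν * h3

end Recurrences

/-! ### The `q`-binomial theorem for the first particle -/

section Infinite

open Filter Topology

theorem summable_mul_pow (a : ℝ) {q : ℝ} (hq : |q| < 1) : Summable fun i : ℕ => ‖-(a * q ^ i)‖ := by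
  simp only [norm_neg, norm_mul, norm_pow, Real.norm_eq_abs]
  exact (summable_geometric_of_lt_one (abs_nonneg q) hq).mul_left _

theorem tendsto_qPoch (a : ℝ) {q : ℝ} (hq : |q| < 1) :
    Tendsto (fun n => qPoch a q n) atTop (𝓝 (qPochInf a q)) := by
  have h : Multipliable fun i : ℕ => 1 + -(a * q ^ i) :=
    multipliable_one_add_of_summable (summable_mul_pow a hq)
  simpa [qPoch, qPochInf, sub_eq_add_neg] using h.hasProd.tendsto_prod_nat

theorem qPochInf_ne_zero {a q : ℝ} (ha : |a| < 1) (hq : |q| < 1) : qPochInf a q ≠ 0 := by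
  have h := tprod_one_add_ne_zero_of_summable (f := fun i : ℕ => -(a * q ^ i))
    (fun i => by simpa [sub_eq_add_neg] using one_sub_mul_pow_ne_zero ha hq i)
    (summable_mul_pow a hq)
  simpa [qPochInf, sub_eq_add_neg] using h

/-- The coefficients `(ν/μ;q)_j μ^j / (q;q)_j` of the `q`-binomial series. -/
def qBinomCoeff (q μ ν : ℝ) (j : ℕ) : ℝ :=
  (∏ i ∈ Finset.range j, (μ - ν * q ^ i)) / qPoch q q j

variable {q μ ν : ℝ}

theorem jumpProb_top (h0 : μ = 0 → ν = 0) (j : ℕ) :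
    jumpProb q μ ν j ⊤ = qPochInf μ q / qPochInf ν q * qBinomCoeff q μ ν j := by
  have h : jumpProb q μ ν j ⊤ =
    μ ^ j * (qPoch (ν / μ) q j * qPochInf μ q / qPochInf ν q) * (1 / qPoch q q j) := rfl
  rw [h, qBinomCoeff, ← pow_mul_qPoch_div h0]
  ring

theorem qBinomCoeff_succ (hq : |q| < 1) (j : ℕ) :
    qBinomCoeff q μ ν (j + 1) * (1 - q ^ (j + 1)) = qBinomCoeff q μ ν j * (μ - ν * q ^ j) := by
  have h1 := qPoch_ne_zero hq hq j
  have h2 := one_sub_mul_pow_ne_zero hq hq j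
  rw [qBinomCoeff, qBinomCoeff, qPoch_succ, Finset.prod_range_succ, pow_succ' q j]
  generalize 1 - q * q ^ j = D at *
  field_simp

theorem summable_qBinomCoeff (hq : |q| < 1) (hμ : |μ| < 1) :
    Summable fun j => ‖qBinomCoeff q μ ν j‖ := by
  have hlim : Tendsto (fun j : ℕ => ‖(μ - ν * q ^ j) / (1 - q ^ (j + 1))‖) atTop (𝓝 ‖μ‖) := by
    have h := tendsto_pow_atTop_nhds_zero_of_abs_lt_one hq
    have h' := (tendsto_add_atTop_iff_nat 1).2 h
    have := ((h.const_mul ν).const_sub μ).div (h'.const_sub 1) (by norm_num)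
    simpa using this.norm
  obtain ⟨r, hr, hr1⟩ := exists_between hμ
  refine summable_of_ratio_norm_eventually_le (r := r) hr1 ?_
  filter_upwards [hlim.eventually_le_const hr] with j hj
  have h2 := one_sub_mul_pow_ne_zero hq hq j
  rw [← pow_succ'] at h2
  have h3 : qBinomCoeff q μ ν (j + 1) =
      (μ - ν * q ^ j) / (1 - q ^ (j + 1)) * qBinomCoeff q μ ν j := by
    rw [div_mul_eq_mul_div, eq_div_iff h2, qBinomCoeff_succ hq]; ring
  rw [h3, norm_mul, norm_mul, norm_norm]
  gcongr

theorem summable_qBinomCoeff_mul (hq : |q| < 1) (hμ : |μ| < 1) (y : ℕ) :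
    Summable fun j => qBinomCoeff q μ ν j * q ^ (j * y) := by
  refine Summable.of_norm_bounded (summable_qBinomCoeff hq hμ (ν := ν)) fun j => ?_
  rw [norm_mul, norm_pow]
  exact mul_le_of_le_one_right (norm_nonneg _) (pow_le_one₀ (norm_nonneg _) hq.le)

/-- The functional equation `(1 - μ z) f(z) = (1 - ν z) f(q z)` of the `q`-binomial series `f`,
at `z = q ^ y`. -/
theorem tsum_qBinomCoeff_succ (hq : |q| < 1) (hμ : |μ| < 1) (y : ℕ) :
    (1 - ν * q ^ y) * ∑' j, qBinomCoeff q μ ν j * q ^ (j * (y + 1)) =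
      (1 - μ * q ^ y) * ∑' j, qBinomCoeff q μ ν j * q ^ (j * y) := by
  have hs := summable_qBinomCoeff_mul (ν := ν) hq hμ y
  have hs' := summable_qBinomCoeff_mul (ν := ν) hq hμ (y + 1)
  have h1 : ∑' j, (qBinomCoeff q μ ν j * q ^ (j * y) - qBinomCoeff q μ ν j * q ^ (j * (y + 1))) =
      ∑' j, (q ^ y * μ * (qBinomCoeff q μ ν j * q ^ (j * y)) -
        q ^ y * ν * (qBinomCoeff q μ ν j * q ^ (j * (y + 1)))) := by
    rw [(hs.sub hs').tsum_eq_zero_add]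
    simp only [zero_mul, pow_zero, sub_self, zero_add]
    refine tsum_congr fun j => ?_
    have h := qBinomCoeff_succ (μ := μ) (ν := ν) hq j
    simp only [add_mul, mul_add, pow_add, mul_one, one_mul, pow_one] at h ⊢
    linear_combination q ^ (j * y) * q ^ y * h
  rw [hs.tsum_sub hs', (hs.mul_left _).tsum_sub (hs'.mul_left _), tsum_mul_left, tsum_mul_left]
    at h1
  linear_combination -h1

theorem tendsto_tsum_qBinomCoeff (hq : |q| < 1) (hμ : |μ| < 1) :
    Tendsto (fun y : ℕ => ∑' j, qBinomCoeff q μ ν j * q ^ (j * y)) atTop (𝓝 1) := by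
  have h1 : ∑' j : ℕ, (if j = 0 then (1 : ℝ) else 0) = 1 := by simp
  rw [← h1]
  refine tendsto_tsum_of_dominated_convergence (summable_qBinomCoeff hq hμ (ν := ν)) ?_ ?_
  · intro j
    rcases Nat.eq_zero_or_pos j with rfl | hj
    · simp [qBinomCoeff]
    · have : Tendsto (fun y : ℕ => (q ^ j) ^ y) atTop (𝓝 0) := by
        refine tendsto_pow_atTop_nhds_zero_of_abs_lt_one ?_
        rw [abs_pow]
        exact pow_lt_one₀ (abs_nonneg _) hq hj.ne'
      simpa [hj.ne', pow_mul] using this.const_mul (qBinomCoeff q μ ν j)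
  · refine Eventually.of_forall fun y j => ?_
    rw [norm_mul, norm_pow]
    exact mul_le_of_le_one_right (norm_nonneg _) (pow_le_one₀ (norm_nonneg _) hq.le)

theorem tsum_qBinomCoeff (hq : |q| < 1) (hμ : |μ| < 1) (hν : |ν| < 1) (y : ℕ) :
    ∑' j, qBinomCoeff q μ ν j * q ^ (j * y) =
      qPochInf ν q / qPochInf μ q * (qPoch μ q y / qPoch ν q y) := by
  have h : ∀ y : ℕ, (∑' j, qBinomCoeff q μ ν j * q ^ (j * y)) * qPoch ν q y =
      (∑' j, qBinomCoeff q μ ν j * q ^ (j * 0)) * qPoch μ q y := by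
    intro y
    induction y with
    | zero => simp
    | succ y ih =>
      rw [qPoch_succ, qPoch_succ]
      linear_combination (1 - μ * q ^ y) * ih + qPoch ν q y * tsum_qBinomCoeff_succ (ν := ν) hq hμ y
  have h0 := tendsto_nhds_unique
    ((tendsto_tsum_qBinomCoeff (ν := ν) hq hμ).mul (tendsto_qPoch ν hq))
    (((tendsto_qPoch μ hq).const_mul _).congr fun y => (h y).symm)
  have h1 := qPoch_ne_zero hν hq y
  have h2 := qPochInf_ne_zero hμ hq
  have h3 := h y
  rw [one_mul] at h0
  rw [← eq_div_iff h1] at h3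
  rw [h3, h0]
  field_simp

/-- The `q`-moments of the jump of the first particle. -/
theorem hasSum_jumpProb_top (hq : |q| < 1) (hμ : |μ| < 1) (hν : |ν| < 1) (h0 : μ = 0 → ν = 0)
    (y : ℕ) : HasSum (fun j => jumpProb q μ ν j ⊤ * q ^ (j * y)) (hahn q μ ν y 0) := by
  have h := (summable_qBinomCoeff_mul (ν := ν) hq hμ y).hasSum
  rw [tsum_qBinomCoeff hq hμ hν] at h
  have h2 := qPochInf_ne_zero hμ hq
  have h3 := qPochInf_ne_zero hν hq
  have h4 := h.mul_left (qPochInf μ q / qPochInf ν q)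
  have e : qPochInf μ q / qPochInf ν q *
      (qPochInf ν q / qPochInf μ q * (qPoch μ q y / qPoch ν q y)) = hahn q μ ν y 0 := by
    rw [hahn_zero_right hq]; field_simp
  rw [e] at h4
  simpa only [jumpProb_top h0, mul_assoc] using h4

/-- The `q`-moments of the jump of a particle with `m` free sites in front of it. -/
theorem hasSum_jumpProb_natCast (hq : |q| < 1) (hν : |ν| < 1) (h0 : μ = 0 → ν = 0)
    (m y : ℕ) : HasSum (fun j => jumpProb q μ ν j (m : ℕ∞) * q ^ (j * y))
      (∑ s ∈ Finset.range (y + 1), hahn q μ ν y s * q ^ (s * m)) := by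
  have h := hahnMoment_symm (μ := μ) hq hν m y
  rw [hahnMoment, hahnMoment] at h
  rw [← h]
  simp only [jumpProb_natCast h0]
  refine hasSum_sum_of_ne_finset_zero fun j hj => ?_
  rw [hahn_of_lt (by simpa using hj), zero_mul]

end Infinite

/-! ### A noncommutative `q`-binomial theorem -/

section Ring

variable {R : Type*} [Ring R] [Algebra ℝ R] {q μ ν : ℝ} {X Y : R}

/-- How `X` moves past powers of `Y - ν X` when `Y X = q X Y`. -/
theorem qComm_pow (h : Y * X = q • (X * Y)) (r : ℕ) :
    (Y - ν • X) ^ (r + 1) * X + ((1 - q ^ (r + 1)) * ν) • (X * (Y - ν • X) ^ r * X) =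
      q ^ (r + 1) • (X * (Y - ν • X) ^ (r + 1)) := by
  have hL : (Y - ν • X) * X = q • (X * (Y - ν • X)) - ((1 - q) * ν) • (X * X) := by
    rw [sub_mul, h, mul_sub, smul_mul_assoc, mul_smul_comm]
    module
  generalize Y - ν • X = L at *
  induction r with
  | zero => simp only [zero_add, pow_one, pow_zero, mul_one, hL]; module
  | succ r ih =>
    have e1 : L ^ (r + 1 + 1) * X = L * (L ^ (r + 1) * X) := by rw [pow_succ' L (r + 1), mul_assoc]
    have e2 : L ^ (r + 1) * X = q ^ (r + 1) • (X * L ^ (r + 1)) -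
      ((1 - q ^ (r + 1)) * ν) • (X * L ^ r * X) := by rw [← ih]; abel
    have e3 : L * (X * L ^ (r + 1)) = q • (X * L ^ (r + 1 + 1)) -
        ((1 - q) * ν) • (X * (X * L ^ (r + 1))) := by
      rw [← mul_assoc, hL, sub_mul, smul_mul_assoc, smul_mul_assoc, mul_assoc, mul_assoc,
        ← pow_succ']
    have e4 : L * (X * L ^ r * X) = q • (X * (L ^ (r + 1) * X)) -
        ((1 - q) * ν) • (X * (X * L ^ r * X)) := by
      rw [← mul_assoc, ← mul_assoc, hL, sub_mul, sub_mul, smul_mul_assoc, smul_mul_assoc,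
        smul_mul_assoc, smul_mul_assoc, pow_succ' L r]
      simp only [mul_assoc]
    have e6 : q ^ (r + 1) • (X * (X * L ^ (r + 1))) = X * (L ^ (r + 1) * X) +
        ((1 - q ^ (r + 1)) * ν) • (X * (X * L ^ r * X)) := by
      rw [e2, mul_sub, mul_smul_comm, mul_smul_comm]; abel
    have e7 : X * L ^ (r + 1) * X = X * (L ^ (r + 1) * X) := mul_assoc _ _ _
    rw [e1, e2, mul_sub, mul_smul_comm, mul_smul_comm, e3, e4, e7, smul_sub, smul_comm _ (_ * ν),
      e6]
    rw [pow_succ q (r + 1)]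
    module

/-- One draw of the urn in `qComm_sum`, up to terms that telescope: here `u = q^s` and
`r = y - s`. -/
theorem qComm_step (h : Y * X = q • (X * Y)) (r : ℕ) (u : ℝ) :
    (1 - μ * q ^ r) • (Y - ν • X) ^ (r + 1) +
        ((μ - ν * u) * q ^ r) • ((Y - X) * (Y - ν • X) ^ r) =
      (1 - ν * (u * q ^ r)) • ((Y - ν • X) ^ r * (Y - μ • X)) +
        ν • (((1 - q ^ r) * (μ - ν * u)) • ((Y - X) * (Y - ν • X) ^ (r - 1) * X) -
          ((1 - u) * (1 - μ * q ^ r)) • ((Y - ν • X) ^ r * X)) := by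
  have h1 : Y - X = (Y - ν • X) - (1 - ν) • X := by module
  have hμ : Y - μ • X = (Y - ν • X) - (μ - ν) • X := by module
  have hk := qComm_pow (ν := ν) h
  rw [h1, hμ]
  generalize Y - ν • X = L at *
  rcases r with _ | r
  · simp only [pow_zero, mul_one, one_mul, zero_add, pow_one, sub_self, zero_mul, zero_smul]
    module
  · have k := hk r
    have e1 : (L - (1 - ν) • X) * L ^ (r + 1) = L ^ (r + 1 + 1) - (1 - ν) • (X * L ^ (r + 1)) := by
      rw [sub_mul, smul_mul_assoc, ← pow_succ']
    have e2 : L ^ (r + 1) * (L - (μ - ν) • X) = L ^ (r + 1 + 1) - (μ - ν) • (L ^ (r + 1) * X) := by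
      rw [mul_sub, mul_smul_comm, ← pow_succ]
    have e3 : (L - (1 - ν) • X) * L ^ (r + 1 - 1) * X =
        L ^ (r + 1) * X - (1 - ν) • (X * L ^ r * X) := by
      rw [Nat.add_sub_cancel, sub_mul, sub_mul, smul_mul_assoc, smul_mul_assoc, ← pow_succ']
    rw [e1, e2, e3]
    generalize q ^ (r + 1) = Q at *
    have k' : ((μ - ν * u) * Q) • (X * L ^ (r + 1)) = (μ - ν * u) • (L ^ (r + 1) * X +
        ((1 - Q) * ν) • (X * L ^ r * X)) := by rw [k, smul_smul]
    rw [smul_sub ((μ - ν * u) * Q), smul_comm ((μ - ν * u) * Q), k']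
    module

/-- If `Y X = q X Y` then `(Y - μ X)^y` is the average of `(Y - X)^s (Y - ν X)^{y-s}` over `s`
distributed as `φ(·|y)`. -/
theorem qComm_sum (hq : |q| < 1) (hν : |ν| < 1) (h : Y * X = q • (X * Y)) (y : ℕ) :
    ∑ s ∈ Finset.range (y + 1), hahn q μ ν y s • ((Y - X) ^ s * (Y - ν • X) ^ (y - s)) =
      (Y - μ • X) ^ y := by
  induction y with
  | zero => simp [hahn]
  | succ y ih =>
    have hs := one_sub_mul_pow_ne_zero hν hq y
    apply smul_right_injective R hs
    have h1 := sum_hahn_succ (μ := μ) hq hν y fun s => (Y - X) ^ s * (Y - ν • X) ^ (y + 1 - s)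
    simp only
    rw [h1, pow_succ, ← ih]
    -- the correction terms of `qComm_step` telescope
    set T : ℕ → R := fun s => (hahn q μ ν y s * (1 - q ^ s) * (1 - μ * q ^ (y - s))) •
      ((Y - X) ^ s * (Y - ν • X) ^ (y - s) * X) with hT
    have h2 : ∀ s ∈ Finset.range (y + 1),
        hahn q μ ν y s • ((1 - μ * q ^ (y - s)) • ((Y - X) ^ s * (Y - ν • X) ^ (y + 1 - s)) +
          ((μ - ν * q ^ s) * q ^ (y - s)) • ((Y - X) ^ (s + 1) * (Y - ν • X) ^ (y + 1 - (s + 1)))) =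
        (1 - ν * q ^ y) • (hahn q μ ν y s • ((Y - X) ^ s * (Y - ν • X) ^ (y - s)) * (Y - μ • X)) +
          ν • (T (s + 1) - T s) := by
      intro s hsy
      have hsy' : s ≤ y := by simpa [Nat.lt_succ_iff] using hsy
      have h3 := congrArg (fun z => hahn q μ ν y s • ((Y - X) ^ s * z))
        (qComm_step (μ := μ) (ν := ν) h (y - s) (q ^ s))
      have h4 : T (s + 1) = (hahn q μ ν y s * (1 - q ^ (y - s)) * (μ - ν * q ^ s)) •
          ((Y - X) ^ s * ((Y - X) * (Y - ν • X) ^ (y - s - 1) * X)) := by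
        rcases eq_or_lt_of_le hsy' with rfl | hlt
        · simp only [hT]
          rw [hahn_of_lt (Nat.lt_succ_self _)]
          simp
        · simp only [hT]
          rw [hahn_succ_right hq hν hlt, Nat.sub_sub, pow_succ]
          simp only [mul_assoc]
      have e1 : q ^ s * q ^ (y - s) = q ^ y := by rw [← pow_add]; congr 1; omega
      rw [e1] at h3
      rw [h4, show y + 1 - (s + 1) = y - s by omega, show y + 1 - s = y - s + 1 by omega,
        pow_succ (Y - X) s, mul_assoc ((Y - X) ^ s) (Y - X)]
      simp only [mul_add, mul_smul_comm, mul_sub, smul_mul_assoc] at h3 ⊢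
      rw [h3]
      simp only [hT]
      rw [mul_assoc ((Y - X) ^ s) ((Y - ν • X) ^ (y - s)) X,
        mul_assoc ((Y - X) ^ s) ((Y - ν • X) ^ (y - s)) Y]
      module
    rw [Finset.sum_congr rfl h2, Finset.sum_add_distrib, ← Finset.smul_sum, ← Finset.smul_sum,
      Finset.sum_range_sub, ← Finset.sum_mul]
    have e0 : T 0 = 0 := by simp [hT]
    have e1 : T (y + 1) = 0 := by simp [hT, hahn_of_lt]
    rw [e0, e1]
    simp

/-- The same in the generators `a`, `b`, which are tied by a quadratic relation. -/
theorem quadratic_sum {a b : R} (hq : |q| < 1) (hν : |ν| < 1)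
    (h : (1 - q) • (b * b) + (q * ν - 1) • (b * a) + (q - ν) • (a * b) +
      (ν * (1 - q)) • (a * a) = 0) (y : ℕ) :
    (((μ - ν) / (1 - ν)) • a + (1 - (μ - ν) / (1 - ν)) • b) ^ y =
      ∑ s ∈ Finset.range (y + 1), hahn q μ ν y s • (a ^ s * b ^ (y - s)) := by
  have h1 : (1 - ν) ≠ 0 := by simpa using one_sub_mul_pow_ne_zero hν hq 0
  have hXY : (b - ν • a) * (b - a) = q • ((b - a) * (b - ν • a)) := by
    rw [← sub_eq_zero, ← h]
    simp only [mul_sub, sub_mul, mul_smul_comm, smul_mul_assoc, smul_sub]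
    module
  have h2 := qComm_sum (μ := μ) hq hν hXY y
  have e1 : b - ν • a - (b - a) = (1 - ν) • a := by module
  have e2 : b - ν • a - ν • (b - a) = (1 - ν) • b := by module
  have e3 : b - ν • a - μ • (b - a) =
      (1 - ν) • (((μ - ν) / (1 - ν)) • a + (1 - (μ - ν) / (1 - ν)) • b) := by
    rw [smul_add, smul_smul, smul_smul, mul_sub, mul_div_cancel₀ _ h1]
    module
  rw [e1, e2, e3, smul_pow] at h2
  apply smul_right_injective R (pow_ne_zero y h1)
  simp only
  rw [← h2, Finset.smul_sum]
  refine Finset.sum_congr rfl fun s hs => ?_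
  have hs' : s + (y - s) = y := by have := Finset.mem_range.1 hs; omega
  rw [smul_pow, smul_pow, smul_mul_smul_comm, ← pow_add, hs', smul_comm]

end Ring

/-! ### Free evolution with two-body boundary conditions -/

/-- The operator `V ↦ V(m, ·)` on functions of finite sequences. -/
def consL (m : ℕ) : (List ℕ → ℂ) →ₗ[ℝ] (List ℕ → ℂ) := LinearMap.funLeft ℝ ℂ (List.cons m)

@[simp] theorem consL_apply (m : ℕ) (V : List ℕ → ℂ) (l : List ℕ) : consL m V l = V (m :: l) := rfl

theorem consL_pow_apply (m s : ℕ) (V : List ℕ → ℂ) (l : List ℕ) :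
    (consL m ^ s) V l = V (List.replicate s m ++ l) := by
  induction s generalizing l with
  | zero => simp
  | succ s ih =>
    rw [pow_succ', Module.End.mul_apply, consL_apply, ih, List.replicate_succ']
    simp

/-- The functions `V` of finite sequences that satisfy the two-body boundary condition wherever
two neighbouring entries coincide. -/
def boundary (q ν : ℝ) : Submodule ℝ (List ℕ → ℂ) where
  carrier := {V | ∀ l m r,
    (1 - q) • V (l ++ (m + 1) :: (m + 1) :: r) + (q * ν - 1) • V (l ++ m :: (m + 1) :: r) +
      (q - ν) • V (l ++ (m + 1) :: m :: r) + (ν * (1 - q)) • V (l ++ m :: m :: r) = 0}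
  add_mem' {V W} hV hW l m r := by
    have := congrArg₂ (· + ·) (hV l m r) (hW l m r)
    simp only [Pi.add_apply, smul_add, add_zero] at this ⊢
    rw [← this]; abel
  zero_mem' l m r := by simp
  smul_mem' c V hV l m r := by
    have := congrArg (c • ·) (hV l m r)
    simp only [Pi.smul_apply, smul_add, smul_zero] at this ⊢
    rw [← this, smul_comm c, smul_comm c, smul_comm c, smul_comm c]

theorem consL_mem_boundary {q ν : ℝ} (m : ℕ) {V : List ℕ → ℂ} (hV : V ∈ boundary q ν) :
    consL m V ∈ boundary q ν := fun l m' r => hV (m :: l) m' r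

theorem consL_pow_mem_boundary {q ν : ℝ} (m s : ℕ) {V : List ℕ → ℂ} (hV : V ∈ boundary q ν) :
    (consL m ^ s) V ∈ boundary q ν := by
  induction s with
  | zero => exact hV
  | succ s ih => rw [pow_succ', Module.End.mul_apply]; exact consL_mem_boundary m ih

/-- One step of the free evolution: every entry independently drops by one with weight `p`. -/
def freeStep (p : ℝ) : List ℕ → (List ℕ → ℂ) →ₗ[ℝ] ℂ
  | [] => LinearMap.proj []
  | m :: r => freeStep p r ∘ₗ (p • consL (m - 1) + (1 - p) • consL m)

theorem freeStep_replicate_append (p : ℝ) (m y : ℕ) (r : List ℕ) :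
    freeStep p (List.replicate y (m + 1) ++ r) =
      freeStep p r ∘ₗ (p • consL m + (1 - p) • consL (m + 1)) ^ y := by
  induction y with
  | zero => rfl
  | succ y ih =>
    rw [List.replicate_succ, List.cons_append, freeStep, ih, Nat.add_sub_cancel, pow_succ]
    rfl

/-- The decreasing sequence that contains `m` exactly `y m` times, for `1 ≤ m ≤ M`. -/
def clusterList (y : ℕ → ℕ) : ℕ → List ℕ
  | 0 => []
  | M + 1 => List.replicate (y (M + 1)) (M + 1) ++ clusterList y M

/-- One step of the `(q,μ,ν)`-Boson process: of the `y m` entries equal to `m`, a number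
distributed as `φ(·|y m)` drops by one. -/
def bosonStep (q μ ν : ℝ) (y : ℕ → ℕ) : ℕ → (List ℕ → ℂ) →ₗ[ℝ] ℂ
  | 0 => LinearMap.proj []
  | M + 1 => ∑ s ∈ Finset.range (y (M + 1) + 1), hahn q μ ν (y (M + 1)) s •
      bosonStep q μ ν y M ∘ₗ (consL M ^ s * consL (M + 1) ^ (y (M + 1) - s))

theorem quadratic_consL {q μ ν : ℝ} (hq : |q| < 1) (hν : |ν| < 1) {V : List ℕ → ℂ}
    (hV : V ∈ boundary q ν) (m y : ℕ) :
    ((((μ - ν) / (1 - ν)) • consL m + (1 - (μ - ν) / (1 - ν)) • consL (m + 1)) ^ y) V =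
      ∑ s ∈ Finset.range (y + 1),
        hahn q μ ν y s • (consL m ^ s * consL (m + 1) ^ (y - s)) V := by
  let c : ℕ → Module.End ℝ (boundary q ν) := fun i =>
    (consL i).restrict fun _ => consL_mem_boundary i
  have hc : ∀ (i : ℕ) (W : boundary q ν), ((c i W : boundary q ν) : List ℕ → ℂ) = consL i W :=
    fun i W => rfl
  have hrel : (1 - q) • (c (m + 1) * c (m + 1)) + (q * ν - 1) • (c (m + 1) * c m) +
      (q - ν) • (c m * c (m + 1)) + (ν * (1 - q)) • (c m * c m) = 0 := by
    ext W l
    exact W.2 [] m l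
  have h := congrArg (fun f : Module.End ℝ (boundary q ν) => ((f ⟨V, hV⟩ : boundary q ν) :
    List ℕ → ℂ)) (quadratic_sum (μ := μ) hq hν hrel y)
  have hpow : ∀ (i s : ℕ) (W : boundary q ν),
      (((c i ^ s) W : boundary q ν) : List ℕ → ℂ) = (consL i ^ s) W := by
    intro i s
    induction s with
    | zero => intro W; rfl
    | succ s ih => intro W; rw [pow_succ', pow_succ', Module.End.mul_apply, Module.End.mul_apply,
        hc, ih]
  have hpow' : ∀ (s : ℕ) (W : boundary q ν),
      ((((((μ - ν) / (1 - ν)) • c m + (1 - (μ - ν) / (1 - ν)) • c (m + 1)) ^ s) W :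
        boundary q ν) : List ℕ → ℂ) =
      ((((μ - ν) / (1 - ν)) • consL m + (1 - (μ - ν) / (1 - ν)) • consL (m + 1)) ^ s) W := by
    intro s
    induction s with
    | zero => intro W; rfl
    | succ s ih =>
      intro W
      rw [pow_succ', pow_succ', Module.End.mul_apply, Module.End.mul_apply, ← ih]
      rfl
  simp only [hpow'] at h
  rw [h]
  simp [LinearMap.sum_apply, hpow]

/-- On functions that satisfy the boundary condition, the free evolution and the Boson process
agree. -/
theorem freeStep_clusterList {q μ ν : ℝ} (hq : |q| < 1) (hν : |ν| < 1) (y : ℕ → ℕ) (M : ℕ)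
    {V : List ℕ → ℂ} (hV : V ∈ boundary q ν) :
    freeStep ((μ - ν) / (1 - ν)) (clusterList y M) V = bosonStep q μ ν y M V := by
  induction M generalizing V with
  | zero => rfl
  | succ M ih =>
    rw [clusterList, freeStep_replicate_append, LinearMap.comp_apply, quadratic_consL hq hν hV,
      map_sum, bosonStep, LinearMap.sum_apply]
    refine Finset.sum_congr rfl fun s _ => ?_
    rw [map_smul, Module.End.mul_apply,
      ih (consL_pow_mem_boundary _ _ (consL_pow_mem_boundary _ _ hV))]
    rfl

/-! ### Contour integrals -/

section Contours

open Set

theorem intervalIntegrable_deriv_of_piecewise {f : ℝ → ℂ} (S : Finset ℝ) {a b : ℝ} (hab : a ≤ b)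
    (h : ∀ a' b' : ℝ, a ≤ a' → a' < b' → b' ≤ b → (∀ s ∈ S, s ∉ Ioo a' b') →
      ContDiffOn ℝ 1 f (Icc a' b')) : IntervalIntegrable (deriv f) volume a b := by
  induction S using Finset.induction_on generalizing a b with
  | empty =>
    rcases hab.eq_or_lt with rfl | hlt
    · exact IntervalIntegrable.refl
    · have hc := (h a b le_rfl hlt le_rfl (by simp)).continuousOn_derivWithin
        (uniqueDiffOn_Icc hlt) le_rfl
      have hi := (hc.intervalIntegrable_of_Icc (μ := volume) hab)
      rw [intervalIntegrable_iff_integrableOn_Ioo_of_le hab] at hi ⊢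
      refine hi.congr_fun (fun x hx => ?_) measurableSet_Ioo
      exact derivWithin_of_mem_nhds (Icc_mem_nhds hx.1 hx.2)
  | insert s S _ ih =>
    by_cases hs : s ∈ Ioo a b
    · refine (ih hs.1.le fun a' b' h1 h2 h3 h4 => h a' b' h1 h2 (h3.trans hs.2.le) ?_).trans
        (ih hs.2.le fun a' b' h1 h2 h3 h4 => h a' b' (hs.1.le.trans h1) h2 h3 ?_)
      · intro x hx
        rcases Finset.mem_insert.1 hx with rfl | hx
        · exact fun h' => absurd h'.2 h3.not_gt
        · exact h4 x hx
      · intro x hx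
        rcases Finset.mem_insert.1 hx with rfl | hx
        · exact fun h' => absurd h'.1 h1.not_gt
        · exact h4 x hx
    · refine ih hab fun a' b' h1 h2 h3 h4 => h a' b' h1 h2 h3 fun x hx => ?_
      rcases Finset.mem_insert.1 hx with rfl | hx
      · exact fun h' => hs ⟨h1.trans_lt h'.1, h'.2.trans_le h3⟩
      · exact h4 x hx

variable (γ : Contour)

/-- The parametrization of a contour, extended to `ℝ` by constants. -/
def Contour.param (t : ℝ) : ℂ := γ.path.extend t

theorem Contour.continuous_param : Continuous γ.param := γ.path.continuous_extend

theorem Contour.param_mem (t : ℝ) : γ.param t ∈ γ.trace := mem_range_self _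

theorem Contour.isCompact_trace : IsCompact γ.trace := isCompact_range γ.path.continuous

theorem Contour.trace_nonempty : γ.trace.Nonempty := range_nonempty _

theorem Contour.intervalIntegrable_deriv : IntervalIntegrable (deriv γ.param) volume 0 1 := by
  obtain ⟨S, hS⟩ := γ.piecewiseC1
  exact intervalIntegrable_deriv_of_piecewise S zero_le_one fun a' b' h1 h2 h3 h4 =>
    hS a' b' h1 h2 h3 h4

theorem contourIntegral_eq (f : ℂ → ℂ) :
    contourIntegral γ f = ∫ t in (0 : ℝ)..1, f (γ.param t) * deriv γ.param t := by
  rw [contourIntegral, curveIntegral_eq_intervalIntegral_deriv]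
  simp [Contour.param, smul_eq_mul]
  rfl

variable {γ} {f g : ℂ → ℂ}

theorem Contour.intervalIntegrable (hf : ContinuousOn f γ.trace) :
    IntervalIntegrable (fun t => f (γ.param t) * deriv γ.param t) volume 0 1 :=
  γ.intervalIntegrable_deriv.continuousOn_mul
    (hf.comp_continuous γ.continuous_param γ.param_mem).continuousOn

/-- If `f` has a primitive near the contour, its integral along the contour vanishes. -/
theorem contourIntegral_eq_zero_of_primitive {F : ℂ → ℂ}
    (hF : ∀ z ∈ γ.trace, HasDerivAt F (f z) z) (hf : ContinuousOn f γ.trace) :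
    contourIntegral γ f = 0 := by
  obtain ⟨S, hS⟩ := γ.piecewiseC1
  have hd : ∀ t ∈ Ioo (0 : ℝ) 1 \ (S : Set ℝ), DifferentiableAt ℝ γ.param t := by
    rintro t ⟨ht, htS⟩
    have hn : Ioo (0 : ℝ) 1 ∩ (S : Set ℝ)ᶜ ∈ nhds t :=
      (isOpen_Ioo.inter S.finite_toSet.isClosed.isOpen_compl).mem_nhds ⟨ht, htS⟩
    obtain ⟨a, b, hab, hsub⟩ := mem_nhds_iff_exists_Ioo_subset.1 hn
    have ha : max a 0 < t := max_lt hab.1 ht.1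
    have hb : t < min b 1 := lt_min hab.2 ht.2
    have hc := hS (max a 0) (min b 1) (le_max_right _ _) (ha.trans hb) (min_le_right _ _)
      fun s hs hs' => (hsub ⟨(le_max_left _ _).trans_lt hs'.1,
        hs'.2.trans_le (min_le_left _ _)⟩).2 hs
    exact (hc.contDiffAt (Icc_mem_nhds ha hb)).differentiableAt one_ne_zero
  rw [contourIntegral_eq, integral_eq_of_hasDerivAt_off_countable (fun t => F (γ.param t)) _
    S.countable_toSet _ _ (Contour.intervalIntegrable hf)]
  · simp [Contour.param]
  · exact fun t _ => ((hF _ (γ.param_mem t)).continuousAt.comp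
      γ.continuous_param.continuousAt).continuousWithinAt
  · intro t ht
    rw [min_eq_left zero_le_one, max_eq_right zero_le_one] at ht
    exact (hF _ (γ.param_mem t)).comp_of_eq t (hd t ht).hasDerivAt rfl

/-- The properties of the integral along a contour with trace in `K` that its evaluation on
rational functions uses. -/
structure IsIntegralOn (K : Set ℂ) (Λ : (ℂ → ℂ) → ℂ) : Prop where
  add : ∀ f g, ContinuousOn f K → ContinuousOn g K → Λ (fun z => f z + g z) = Λ f + Λ g
  const_mul : ∀ (c : ℂ) f, Λ (fun z => c * f z) = c * Λ f
  congr : ∀ f g, EqOn f g K → Λ f = Λ g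
  primitive : ∀ F f, (∀ z ∈ K, HasDerivAt F (f z) z) → ContinuousOn f K → Λ f = 0

theorem contourIntegral_const_mul (c : ℂ) :
    contourIntegral γ (fun z => c * f z) = c * contourIntegral γ f := by
  simp only [contourIntegral_eq, mul_assoc]
  exact intervalIntegral.integral_const_mul _ _

theorem contourIntegral_congr (h : EqOn f g γ.trace) :
    contourIntegral γ f = contourIntegral γ g := by
  simp only [contourIntegral_eq]
  congr 1
  ext t
  rw [h (γ.param_mem t)]

theorem contourIntegral_add (hf : ContinuousOn f γ.trace) (hg : ContinuousOn g γ.trace) :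
    contourIntegral γ (fun z => f z + g z) = contourIntegral γ f + contourIntegral γ g := by
  simp only [contourIntegral_eq, add_mul]
  exact intervalIntegral.integral_add (Contour.intervalIntegrable hf)
    (Contour.intervalIntegrable hg)

theorem isIntegralOn_contourIntegral (γ : Contour) :
    IsIntegralOn γ.trace (contourIntegral γ) where
  add _ _ := contourIntegral_add
  const_mul _ _ := contourIntegral_const_mul _
  congr _ _ := contourIntegral_congr
  primitive _ _ := contourIntegral_eq_zero_of_primitive

theorem isIntegralOn_sub (γ γ' : Contour) : IsIntegralOn (γ.trace ∪ γ'.trace)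
    fun f => contourIntegral γ f - contourIntegral γ' f where
  add f g hf hg := by
    rw [contourIntegral_add (hf.mono subset_union_left) (hg.mono subset_union_left),
      contourIntegral_add (hf.mono subset_union_right) (hg.mono subset_union_right)]
    ring
  const_mul c f := by rw [contourIntegral_const_mul, contourIntegral_const_mul]; ring
  congr f g h := by
    rw [contourIntegral_congr (h.mono subset_union_left),
      contourIntegral_congr (h.mono subset_union_right)]
  primitive F f hF hf := by
    rw [contourIntegral_eq_zero_of_primitive (fun z hz => hF z (Or.inl hz))
      (hf.mono subset_union_left), contourIntegral_eq_zero_of_primitive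
      (fun z hz => hF z (Or.inr hz)) (hf.mono subset_union_right), sub_zero]

/-! ### Integrals of rational functions -/

/-- The polynomial `∏_{a ∈ L} (z - a)`. -/
def linProd (L : Multiset ℂ) (z : ℂ) : ℂ := (L.map fun a => z - a).prod

@[simp] theorem linProd_zero (z : ℂ) : linProd 0 z = 1 := by simp [linProd]

@[simp] theorem linProd_cons (a : ℂ) (L : Multiset ℂ) (z : ℂ) :
    linProd (a ::ₘ L) z = (z - a) * linProd L z := by simp [linProd]

theorem linProd_add (L L' : Multiset ℂ) (z : ℂ) :
    linProd (L + L') z = linProd L z * linProd L' z := by simp [linProd]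

theorem linProd_ne_zero {L : Multiset ℂ} {z : ℂ} (h : z ∉ L) : linProd L z ≠ 0 := by
  rw [linProd]
  intro h0
  rw [Multiset.prod_eq_zero_iff] at h0
  obtain ⟨a, ha, h1⟩ := Multiset.mem_map.1 h0
  rw [sub_eq_zero] at h1
  exact h (h1 ▸ ha)

theorem continuous_linProd (L : Multiset ℂ) : Continuous (linProd L) := by
  unfold linProd
  exact continuous_multiset_prod L fun a _ => by fun_prop

section Functional

variable {K S : Set ℂ} {Λ : (ℂ → ℂ) → ℂ} (hΛ : IsIntegralOn K Λ)
include hΛ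

theorem IsIntegralOn.inv_pow {a : ℂ} (ha : a ∉ K) (m : ℕ) :
    Λ (fun z => ((z - a) ^ (m + 2))⁻¹) = 0 := by
  have hz : ∀ z ∈ K, z - a ≠ 0 := fun z hz h => ha (sub_eq_zero.1 h ▸ hz)
  refine hΛ.primitive (fun z => -((m : ℂ) + 1)⁻¹ * ((z - a) ^ (m + 1))⁻¹) _ (fun z hzK => ?_)
    (ContinuousOn.inv₀ (by fun_prop) fun z hzK => pow_ne_zero _ (hz z hzK))
  have h1 := hz z hzK
  have h2 : ((m : ℂ) + 1) ≠ 0 := by exact_mod_cast Nat.succ_ne_zero m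
  have h := ((((hasDerivAt_id z).sub_const a).pow (m + 1)).inv
    (pow_ne_zero _ h1)).const_mul (-((m : ℂ) + 1)⁻¹)
  refine h.congr_deriv ?_
  simp only [id, Nat.add_sub_cancel, mul_one, Pi.pow_apply]
  push_cast
  field_simp
  ring

theorem IsIntegralOn.polynomial (P : Polynomial ℂ) : Λ (fun z => P.eval z) = 0 := by
  induction P using Polynomial.induction_on' with
  | add p q hp hq =>
    simp only [Polynomial.eval_add]
    rw [hΛ.add _ _ (by fun_prop) (by fun_prop), hp, hq, add_zero]
  | monomial n a =>
    simp only [Polynomial.eval_monomial]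
    refine hΛ.primitive (fun z => a * (z ^ (n + 1) * ((n : ℂ) + 1)⁻¹)) _ (fun z _ => ?_)
      (by fun_prop)
    have h2 : ((n : ℂ) + 1) ≠ 0 := by exact_mod_cast Nat.succ_ne_zero n
    refine (((hasDerivAt_pow (n + 1) z).mul_const ((n : ℂ) + 1)⁻¹).const_mul a).congr_deriv ?_
    simp only [Nat.add_sub_cancel]
    push_cast
    field_simp

variable {c : ℂ} (hS : ∀ a ∈ S, a ∉ K) (hc : ∀ a ∈ S, Λ (fun z => (z - a)⁻¹) = c)
include hS hc

/-- Two distinct poles are separated by partial fractions, until only powers of one pole are left,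
which have primitives except for the first power. -/
theorem IsIntegralOn.inv_linProd {L : Multiset ℂ} (hL : ∀ a ∈ L, a ∈ S) (h0 : L ≠ 0) :
    Λ (fun z => (linProd L z)⁻¹) = if L.card = 1 then c else 0 := by
  induction hn : L.card using Nat.strong_induction_on generalizing L with
  | _ n ih =>
  obtain ⟨a, ha⟩ := Multiset.exists_mem_of_ne_zero h0
  obtain ⟨L', rfl⟩ := Multiset.exists_cons_of_mem ha
  have haS := hL a (Multiset.mem_cons_self _ _)
  by_cases hL' : ∀ b ∈ L', b = a
  · have hrep : L' = Multiset.replicate L'.card a := Multiset.eq_replicate_card.2 hL'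
    have hf : (fun z => (linProd (a ::ₘ L') z)⁻¹) = fun z => ((z - a) ^ (L'.card + 1))⁻¹ := by
      ext z
      rw [linProd_cons, hrep, linProd, Multiset.map_replicate, Multiset.prod_replicate,
        Multiset.card_replicate, pow_succ']
    rw [hf]
    rw [Multiset.card_cons] at hn
    rcases hm : L'.card with _ | m
    · rw [hm] at hn
      simp [← hn, hc a haS]
    · rw [hm] at hn
      rw [hΛ.inv_pow (hS a haS), if_neg (by omega)]
  · push Not at hL'
    obtain ⟨b, hb, hba⟩ := hL'
    obtain ⟨L'', rfl⟩ := Multiset.exists_cons_of_mem hb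
    have hbS := hL b (by simp)
    have hL2 : ∀ x ∈ L'', x ∈ S := fun x hx => hL x (by simp [hx])
    have hz : ∀ (x : ℂ), x ∈ S → ∀ z ∈ K, z - x ≠ 0 :=
      fun x hx z hz h => hS x hx (sub_eq_zero.1 h ▸ hz)
    have hp : ∀ z ∈ K, linProd L'' z ≠ 0 :=
      fun z hz => linProd_ne_zero fun h => hS z (hL2 z h) hz
    have hcard : (b ::ₘ L'').card < n := by
      rw [← hn]; simp
    have i1 := ih _ hcard (L := a ::ₘ L'') (by
      intro x hx; rcases Multiset.mem_cons.1 hx with rfl | hx; exacts [haS, hL2 x hx])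
      (Multiset.cons_ne_zero) (by simp)
    have i2 := ih _ hcard (L := b ::ₘ L'') (by
      intro x hx; rcases Multiset.mem_cons.1 hx with rfl | hx; exacts [hbS, hL2 x hx])
      (Multiset.cons_ne_zero) (by simp)
    have hcont : ∀ x ∈ S, ContinuousOn (fun z => (linProd (x ::ₘ L'') z)⁻¹) K := by
      intro x hx
      refine (continuous_linProd _).continuousOn.inv₀ fun z hzK => ?_
      rw [linProd_cons]
      exact mul_ne_zero (hz x hx z hzK) (hp z hzK)
    have hab : a - b ≠ 0 := sub_ne_zero.2 hba.symm
    have hdec : Λ (fun z => (linProd (a ::ₘ b ::ₘ L'') z)⁻¹) =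
        Λ (fun z => (a - b)⁻¹ * ((linProd (a ::ₘ L'') z)⁻¹ +
          -1 * (linProd (b ::ₘ L'') z)⁻¹)) := by
      refine hΛ.congr _ _ fun z hzK => ?_
      have h1 := hz a haS z hzK
      have h2 := hz b hbS z hzK
      have h3 := hp z hzK
      simp only [linProd_cons]
      field_simp
      ring
    rw [hdec, hΛ.const_mul, hΛ.add _ _ (hcont a haS) ((hcont b hbS).const_mul _), hΛ.const_mul,
      i1, i2, if_neg (show ¬ n = 1 by simp at hn; omega)]
    ring

/-- The integral of a rational function all of whose poles carry the same weight `c`: it is `c`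
times the coefficient of `z⁻¹` at infinity. -/
theorem IsIntegralOn.div_linProd {L : Multiset ℂ} (hL : ∀ a ∈ L, a ∈ S) (P : Polynomial ℂ)
    (h : c = 0 ∨ P.degree < L.card) :
    Λ (fun z => P.eval z / linProd L z) = c * P.coeff (L.card - 1) := by
  induction L using Multiset.induction_on generalizing P with
  | empty =>
    simp only [linProd_zero, div_one]
    rw [hΛ.polynomial]
    rcases h with rfl | h
    · simp
    · rw [Polynomial.degree_lt_iff_coeff_zero] at h
      rw [h _ (Nat.zero_le _), mul_zero]
  | cons a L ih =>
    have haS := hL a (Multiset.mem_cons_self _ _)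
    have hL2 : ∀ x ∈ L, x ∈ S := fun x hx => hL x (by simp [hx])
    have hp : ∀ z ∈ K, linProd L z ≠ 0 :=
      fun z hz => linProd_ne_zero fun h => hS z (hL2 z h) hz
    have hz : ∀ z ∈ K, z - a ≠ 0 := fun z hz h => hS a haS (sub_eq_zero.1 h ▸ hz)
    set Q := P /ₘ (Polynomial.X - Polynomial.C a) with hQ
    have hP : P = Polynomial.C (P.eval a) + (Polynomial.X - Polynomial.C a) * Q := by
      rw [← Polynomial.modByMonic_X_sub_C_eq_C_eval]
      exact (Polynomial.modByMonic_add_div P (Polynomial.X - Polynomial.C a)).symm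
    have hdec : Λ (fun z => P.eval z / linProd (a ::ₘ L) z) =
        Λ (fun z => Q.eval z / linProd L z + P.eval a * (linProd (a ::ₘ L) z)⁻¹) := by
      refine hΛ.congr _ _ fun z hzK => ?_
      have h1 := hz z hzK
      have h2 := hp z hzK
      have h3 := congrArg (Polynomial.eval z) hP
      simp only [Polynomial.eval_add, Polynomial.eval_mul, Polynomial.eval_sub,
        Polynomial.eval_X, Polynomial.eval_C] at h3
      simp only [linProd_cons]
      rw [h3]
      field_simp
      ring
    have hdeg : c = 0 ∨ Q.degree < L.card := by
      refine h.imp id fun h => ?_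
      rw [Polynomial.degree_lt_iff_coeff_zero] at h ⊢
      intro m hm
      by_contra hne
      have hQ0 : Q ≠ 0 := by rintro h0; simp [h0] at hne
      have hle := Polynomial.le_natDegree_of_ne_zero hne
      have hnd : Q.natDegree = P.natDegree - 1 := by
        rw [hQ, Polynomial.natDegree_divByMonic _ (Polynomial.monic_X_sub_C a),
          Polynomial.natDegree_X_sub_C]
      have hP0 : P ≠ 0 := by rintro h0; simp [hQ, h0] at hQ0
      have hP1 : 1 ≤ P.natDegree := by
        by_contra hlt
        have : P.natDegree = 0 := by omega
        rw [Polynomial.eq_C_of_natDegree_eq_zero this] at hQ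
        apply hQ0
        rw [hQ, Polynomial.divByMonic_eq_zero_iff (Polynomial.monic_X_sub_C a),
          Polynomial.degree_X_sub_C]
        exact Polynomial.degree_C_le.trans_lt (by norm_num)
      have := h P.natDegree (by rw [Multiset.card_cons]; omega)
      exact hP0 (Polynomial.leadingCoeff_eq_zero.1 this)
    rw [hdec, hΛ.add (fun z => Q.eval z / linProd L z)
      (fun z => P.eval a * (linProd (a ::ₘ L) z)⁻¹)
      (Q.continuous.continuousOn.div (continuous_linProd _).continuousOn hp)
      (((continuous_linProd _).continuousOn.inv₀ fun z hzK => by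
        rw [linProd_cons]; exact mul_ne_zero (hz z hzK) (hp z hzK)).const_mul _),
      hΛ.const_mul, ih hL2 Q hdeg, hΛ.inv_linProd hS hc hL Multiset.cons_ne_zero,
      Multiset.card_cons, Nat.add_sub_cancel]
    rcases hdeg with rfl | hdeg
    · simp
    · rw [Polynomial.degree_lt_iff_coeff_zero] at hdeg
      rcases hn : L.card with _ | m
      · rw [hn] at hdeg
        have h4 := congrArg (fun p => p.coeff 0) hP
        simp only [Polynomial.coeff_add, Polynomial.coeff_C_zero, Polynomial.mul_coeff_zero,
          hdeg 0 le_rfl] at h4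
        rw [hdeg _ (Nat.zero_le _), h4]
        simp [mul_comm]
      · rw [hn] at hdeg
        have h4 := congrArg (fun p => p.coeff (m + 1)) hP
        simp only [Polynomial.coeff_add, Polynomial.coeff_C_succ, sub_mul, Polynomial.coeff_sub,
          Polynomial.coeff_X_mul, Polynomial.coeff_C_mul, hdeg (m + 1) le_rfl] at h4
        rw [h4]
        simp

end Functional

end Contours

section Rational

open Set

/-- `f` is given off `S` by a rational function whose poles lie in `S`. -/
def IsRatOn (S : Set ℂ) (f : ℂ → ℂ) : Prop :=
  ∃ (P : Polynomial ℂ) (L : Multiset ℂ), (∀ a ∈ L, a ∈ S) ∧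
    ∀ z ∉ S, f z = P.eval z / linProd L z

variable {S : Set ℂ} {f g : ℂ → ℂ}

theorem IsRatOn.poly (P : Polynomial ℂ) : IsRatOn S fun z => P.eval z :=
  ⟨P, 0, by simp, by simp⟩

theorem IsRatOn.const (c : ℂ) : IsRatOn S fun _ => c := by
  simpa using IsRatOn.poly (S := S) (Polynomial.C c)

theorem IsRatOn.linear (c d : ℂ) : IsRatOn S fun z => c - d * z := by
  have h := IsRatOn.poly (S := S) (Polynomial.C c - Polynomial.C d * Polynomial.X)
  simpa only [Polynomial.eval_sub, Polynomial.eval_mul, Polynomial.eval_C, Polynomial.eval_X]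
    using h

theorem IsRatOn.mul (hf : IsRatOn S f) (hg : IsRatOn S g) : IsRatOn S fun z => f z * g z := by
  obtain ⟨P, L, hL, h⟩ := hf
  obtain ⟨P', L', hL', h'⟩ := hg
  refine ⟨P * P', L + L', fun a ha => ?_, fun z hz => ?_⟩
  · exact (Multiset.mem_add.1 ha).elim (hL a) (hL' a)
  · simp only
    rw [h z hz, h' z hz, Polynomial.eval_mul, linProd_add, div_mul_div_comm]

theorem IsRatOn.pow (hf : IsRatOn S f) (n : ℕ) : IsRatOn S fun z => f z ^ n := by
  induction n with
  | zero => simpa using IsRatOn.const 1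
  | succ n ih => simpa only [pow_succ] using ih.mul hf

theorem IsRatOn.prod {ι : Type*} (s : Finset ι) {f : ι → ℂ → ℂ} (h : ∀ i ∈ s, IsRatOn S (f i)) :
    IsRatOn S fun z => ∏ i ∈ s, f i z := by
  classical
  induction s using Finset.induction_on with
  | empty => simpa using IsRatOn.const 1
  | insert i s his ih =>
    simp only [Finset.prod_insert his]
    exact (h i (Finset.mem_insert_self _ _)).mul
      (ih fun j hj => h j (Finset.mem_insert_of_mem hj))

theorem IsRatOn.inv_linear {c d : ℂ} (h : d ≠ 0 → c / d ∈ S) :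
    IsRatOn S fun z => (c - d * z)⁻¹ := by
  rcases eq_or_ne d 0 with rfl | hd
  · simpa using IsRatOn.const c⁻¹
  · refine ⟨Polynomial.C (-d⁻¹), {c / d}, by simpa using h hd, fun z hz => ?_⟩
    have hz' : z - c / d ≠ 0 := fun h0 => hz (sub_eq_zero.1 h0 ▸ h hd)
    have h2 : c - d * z = -d * (z - c / d) := by field_simp; ring
    simp only [h2, Polynomial.eval_C, linProd, Multiset.map_singleton, Multiset.prod_singleton]
    field_simp

theorem IsRatOn.sub_const (c : ℂ) : IsRatOn S fun z => z - c := by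
  have h := IsRatOn.poly (S := S) (Polynomial.X - Polynomial.C c)
  simpa only [Polynomial.eval_sub, Polynomial.eval_C, Polynomial.eval_X] using h

theorem IsRatOn.inv_sub_const {c : ℂ} (h : c ∈ S) : IsRatOn S fun z => (z - c)⁻¹ :=
  ⟨1, {c}, by simpa using h, fun z _ => by simp [linProd]⟩

theorem Contour.integral_inv_sub (γ : Contour) (w : ℂ) :
    contourIntegral γ (fun z => (z - w)⁻¹) = 2 * Real.pi * Complex.I * γ.winding w := by
  rw [Contour.winding, mul_inv_cancel_left₀]
  simp [Real.pi_ne_zero]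

/-- Cauchy's theorem: only poles about which the contour winds contribute. -/
theorem contourIntegral_eq_zero {γ : Contour} (h : IsRatOn {a | γ.Excludes a} f) :
    contourIntegral γ f = 0 := by
  obtain ⟨P, L, hL, h⟩ := h
  rw [contourIntegral_congr (g := fun z => P.eval z / linProd L z)
    fun z hz => h z fun hz' => hz'.1 hz]
  rw [(isIntegralOn_contourIntegral γ).div_linProd (S := {a | γ.Excludes a}) (c := 0)
    (fun a ha => ha.1) (fun a ha => ?_) hL P (Or.inl rfl), zero_mul]
  rw [γ.integral_inv_sub, ha.2, mul_zero]

/-- A contour may be replaced by another one that winds about the poles in the same way. -/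
theorem contourIntegral_eq_of_winding {γ γ' : Contour}
    (h : IsRatOn {a | a ∉ γ.trace ∧ a ∉ γ'.trace ∧ γ.winding a = γ'.winding a} f) :
    contourIntegral γ f = contourIntegral γ' f := by
  obtain ⟨P, L, hL, h⟩ := h
  rw [contourIntegral_congr (γ := γ) (g := fun z => P.eval z / linProd L z)
    fun z hz => h z fun hz' => hz'.1 hz, contourIntegral_congr (γ := γ')
    (g := fun z => P.eval z / linProd L z) fun z hz => h z fun hz' => hz'.2.1 hz, ← sub_eq_zero]
  have := (isIntegralOn_sub γ γ').div_linProd (c := 0)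
    (S := {a | a ∉ γ.trace ∧ a ∉ γ'.trace ∧ γ.winding a = γ'.winding a})
    (fun a ha h => h.elim ha.1 ha.2.1) (fun a ha => ?_) hL P (Or.inl rfl)
  · simpa using this
  · rw [γ.integral_inv_sub, γ'.integral_inv_sub, ha.2.2, sub_self]

/-- If a contour contains all poles of `P / ∏ (z - a)` but not the origin, then the integral of
`P / (z ∏ (z - a))` is minus the residue at the origin, as there is no residue at infinity. -/
theorem contourIntegral_div_mul_linProd {γ : Contour} {P : Polynomial ℂ} {L : Multiset ℂ}
    (hL : ∀ a ∈ L, γ.Contains a) (h0 : γ.Excludes 0) (hP : P.degree < L.card) :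
    contourIntegral γ (fun z => P.eval z / linProd L z * (1 / z)) =
      -(2 * Real.pi * Complex.I) * (P.eval 0 / linProd L 0) := by
  set c := P.eval 0 / linProd L 0 with hc
  set D : Polynomial ℂ := (L.map fun a => Polynomial.X - Polynomial.C a).prod with hD
  have hDev : ∀ z, D.eval z = linProd L z := by
    intro z
    rw [hD, Polynomial.eval_multiset_prod, Multiset.map_map]
    simp [linProd]
  have hmon : D.Monic := Polynomial.monic_multiset_prod_of_monic _ _
    fun a _ => Polynomial.monic_X_sub_C a
  have hdeg : D.natDegree = L.card := by
    rw [hD, Polynomial.natDegree_multiset_prod_X_sub_C_eq_card]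
  have hL0 : linProd L 0 ≠ 0 := by
    refine linProd_ne_zero fun h => ?_
    have h1 := (hL 0 h).2
    rw [h0.2] at h1
    exact zero_ne_one h1
  have hz0 : ∀ z ∈ γ.trace, z ≠ 0 := fun z hz h => h0.1 (h ▸ hz)
  have hp : ∀ z ∈ γ.trace, linProd L z ≠ 0 :=
    fun z hz => linProd_ne_zero fun h => (hL z h).1 hz
  set Q := (P - Polynomial.C c * D).divX with hQ
  have hPQ : P - Polynomial.C c * D = Polynomial.X * Q := by
    have h1 := Polynomial.X_mul_divX_add (P - Polynomial.C c * D)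
    have h2 : (P - Polynomial.C c * D).coeff 0 = 0 := by
      rw [Polynomial.coeff_zero_eq_eval_zero]
      simp only [Polynomial.eval_sub, Polynomial.eval_mul, Polynomial.eval_C, hDev, hc]
      field_simp
      ring
    rw [h2, Polynomial.C_0, add_zero] at h1
    exact h1.symm
  have hcoeff : ∀ m, Q.coeff m = P.coeff (m + 1) - c * D.coeff (m + 1) := by
    intro m
    rw [hQ, Polynomial.coeff_divX, Polynomial.coeff_sub, Polynomial.coeff_C_mul]
  rw [Polynomial.degree_lt_iff_coeff_zero] at hP
  have hQdeg : Q.degree < L.card := by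
    rw [Polynomial.degree_lt_iff_coeff_zero]
    intro m hm
    rw [hcoeff, hP _ (by omega), Polynomial.coeff_eq_zero_of_natDegree_lt (by omega)]
    ring
  have hdec : EqOn (fun z => P.eval z / linProd L z * (1 / z))
      (fun z => Q.eval z / linProd L z + c * (z - 0)⁻¹) γ.trace := by
    intro z hz
    have h1 := hz0 z hz
    have h2 := hp z hz
    have h3 := congrArg (Polynomial.eval z) hPQ
    simp only [Polynomial.eval_sub, Polynomial.eval_mul, Polynomial.eval_C, hDev,
      Polynomial.eval_X] at h3
    simp only [sub_zero]
    rw [sub_eq_iff_eq_add] at h3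
    rw [h3]
    field_simp
  have hcs : ContinuousOn (fun z : ℂ => c * (z - 0)⁻¹) γ.trace :=
    (ContinuousOn.inv₀ (by fun_prop) fun z hz => by simpa using hz0 z hz).const_mul _
  rw [contourIntegral_congr hdec, contourIntegral_add (f := fun z => Q.eval z / linProd L z)
    (Q.continuous.continuousOn.div (continuous_linProd _).continuousOn hp) hcs,
    contourIntegral_const_mul, γ.integral_inv_sub, h0.2, mul_zero, mul_zero, add_zero,
    (isIntegralOn_contourIntegral γ).div_linProd (S := {a | γ.Contains a})
      (c := 2 * Real.pi * Complex.I) (fun a ha => ha.1)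
      (fun a ha => by rw [γ.integral_inv_sub, ha.2, mul_one]) hL Q (Or.inr hQdeg)]
  rcases hn : L.card with _ | m
  · have hL' : L = 0 := Multiset.card_eq_zero.1 hn
    have hP0 : P = 0 := by
      ext m
      rw [hP m (by omega), Polynomial.coeff_zero]
    have hc0 : c = 0 := by simp [hc, hP0]
    rw [hcoeff, hc0, hP0]
    simp
  · rw [Nat.add_sub_cancel, hcoeff, hP _ hn.le]
    have : D.coeff (m + 1) = 1 := by
      rw [← hn, ← hdeg]; exact hmon
    rw [this]
    ring

/-! ### Winding numbers -/

theorem Contour.winding_eq_of_primitive {γ : Contour} {w w' : ℂ} (hw : w ∉ γ.trace)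
    (hw' : w' ∉ γ.trace) {F : ℂ → ℂ}
    (hF : ∀ z ∈ γ.trace, HasDerivAt F ((z - w)⁻¹ - (z - w')⁻¹) z) :
    γ.winding w = γ.winding w' := by
  have hc : ∀ v ∉ γ.trace, ContinuousOn (fun z => (z - v)⁻¹) γ.trace := fun v hv =>
    ContinuousOn.inv₀ (by fun_prop) fun z hz h => hv (sub_eq_zero.1 h ▸ hz)
  have h1 := contourIntegral_eq_zero_of_primitive hF ((hc w hw).sub (hc w' hw'))
  have h2 : contourIntegral γ (fun z => (z - w)⁻¹ - (z - w')⁻¹) =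
      contourIntegral γ (fun z => (z - w)⁻¹) - contourIntegral γ (fun z => (z - w')⁻¹) := by
    have := contourIntegral_add (hc w hw) ((hc w' hw').const_mul (-1))
    rw [contourIntegral_const_mul] at this
    simpa [sub_eq_add_neg] using this
  rw [h1, eq_comm, sub_eq_zero] at h2
  rw [Contour.winding, Contour.winding, h2]

/-- The winding number is locally constant off the contour. -/
theorem Contour.eventually_winding_eq {γ : Contour} {w : ℂ} (hw : w ∉ γ.trace) :
    ∀ᶠ w' in nhds w, γ.winding w' = γ.winding w := by
  have hpos := (γ.isCompact_trace.isClosed.notMem_iff_infDist_pos γ.trace_nonempty).1 hw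
  filter_upwards [Metric.ball_mem_nhds w hpos] with w' hw'
  have hlt : ∀ z ∈ γ.trace, ‖w - w'‖ < ‖z - w‖ := by
    intro z hz
    have h1 := Metric.infDist_le_dist_of_mem (x := w) hz
    rw [Metric.mem_ball, dist_comm, dist_eq_norm] at hw'
    rw [dist_comm, dist_eq_norm] at h1
    exact hw'.trans_le h1
  have hw1 : w' ∉ γ.trace := fun h => by
    have := hlt w' h
    rw [norm_sub_rev] at this
    exact lt_irrefl _ this
  refine Contour.winding_eq_of_primitive hw1 hw
    (F := fun z => Complex.log ((z - w') / (z - w))) fun z hz => ?_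
  have h1 : z - w ≠ 0 := fun h => hw (sub_eq_zero.1 h ▸ hz)
  have h2 : z - w' ≠ 0 := fun h => hw1 (sub_eq_zero.1 h ▸ hz)
  have hs : (z - w') / (z - w) ∈ Complex.slitPlane := by
    have h3 : (z - w') / (z - w) = 1 + (w - w') / (z - w) := by field_simp; ring
    rw [h3]
    refine Complex.mem_slitPlane_of_norm_lt_one ?_
    rw [norm_div, div_lt_one (norm_pos_iff.2 h1)]
    exact hlt z hz
  refine ((((hasDerivAt_id z).sub_const w').div ((hasDerivAt_id z).sub_const w) h1).clog
    hs).congr_deriv ?_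
  simp only [id, Pi.div_apply]
  field_simp

theorem Contour.winding_comp_eq {γ Γ : Contour} {s : ℂ → ℂ} (hs : Continuous s)
    (h : ∀ z ∈ γ.trace, s z ∉ Γ.trace) {z z' : ℂ} (hz : z ∈ γ.trace) (hz' : z' ∈ γ.trace) :
    Γ.winding (s z) = Γ.winding (s z') := by
  have hl : IsLocallyConstant fun t : ℝ => Γ.winding (s (γ.param t)) := by
    rw [IsLocallyConstant.iff_eventually_eq]
    exact fun t => (hs.comp γ.continuous_param).continuousAt.eventually
      (Contour.eventually_winding_eq (h _ (γ.param_mem t)))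
  have hp : ∀ z ∈ γ.trace, ∃ t, γ.param t = z := by
    rintro z ⟨t, rfl⟩
    exact ⟨t, γ.path.extend_apply t.2⟩
  obtain ⟨t, rfl⟩ := hp z hz
  obtain ⟨t', rfl⟩ := hp z' hz'
  exact hl.apply_eq_of_preconnectedSpace t t'

/-- A contour does not wind about a point off it that is at least as far from the origin as all
points of the contour. -/
theorem Contour.winding_eq_zero_of_norm_le {γ : Contour} {p : ℂ} (hp : p ∉ γ.trace)
    (h : ∀ z ∈ γ.trace, ‖z‖ ≤ ‖p‖) : γ.winding p = 0 := by
  have hp0 : p ≠ 0 := by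
    rintro rfl
    obtain ⟨z, hz⟩ := γ.trace_nonempty
    have := h z hz
    rw [norm_zero, norm_le_zero_iff] at this
    exact hp (this ▸ hz)
  have hF : ∀ z ∈ γ.trace, HasDerivAt (fun z => Complex.log (1 - z / p)) ((z - p)⁻¹) z := by
    intro z hz
    have h1 : z - p ≠ 0 := fun h0 => hp (sub_eq_zero.1 h0 ▸ hz)
    have hs : 1 - z / p ∈ Complex.slitPlane := by
      rw [Complex.mem_slitPlane_iff]
      by_contra! hcon
      obtain ⟨hre, him⟩ := hcon
      have him' : (z / p).im = 0 := by simpa using him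
      have hre' : 1 ≤ (z / p).re := by simpa using hre
      have hle : ‖z / p‖ ≤ 1 := by
        rw [norm_div]; exact div_le_one_of_le₀ (h z hz) (norm_nonneg _)
      have h2 : (z / p).re = 1 := le_antisymm ((Complex.re_le_norm _).trans hle) hre'
      have h3 : z / p = 1 := Complex.ext (by simpa using h2) (by simpa using him')
      exact h1 (by rw [(div_eq_one_iff_eq hp0).1 h3, sub_self])
    refine ((((hasDerivAt_id z).div_const p).const_sub 1).clog hs).congr_deriv ?_
    have h2 : p - z ≠ 0 := fun h0 => h1 (by rw [← neg_sub, h0, neg_zero])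
    simp only [id]
    have h3 : 1 - z / p = (p - z) / p := by field_simp
    rw [h3, ← neg_sub p z]
    field_simp
  rw [Contour.winding, contourIntegral_eq_zero_of_primitive hF, mul_zero]
  exact ContinuousOn.inv₀ (by fun_prop) fun z hz h0 => hp (sub_eq_zero.1 h0 ▸ hz)

/-- If `γ` winds once about every point of `q Γ`, then `Γ` winds about no point of `q⁻¹ γ`: the
trace of `γ` is connected and, having a point farther out than `q Γ`, it lies outside `q Γ`. -/
theorem Contour.excludes_div {γ Γ : Contour} {q : ℂ} (hq : q ≠ 0)
    (h : ∀ w ∈ Γ.trace, γ.Contains (q * w)) {z : ℂ} (hz : z ∈ γ.trace) : Γ.Excludes (z / q) := by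
  have hoff : ∀ z ∈ γ.trace, z / q ∉ Γ.trace := by
    intro z hz hz'
    have := (h _ hz').1
    rw [mul_div_cancel₀ _ hq] at this
    exact this hz
  refine ⟨hoff z hz, ?_⟩
  obtain ⟨a, ha, hamax⟩ := γ.isCompact_trace.exists_isMaxOn γ.trace_nonempty
    continuous_norm.continuousOn
  rw [Contour.winding_comp_eq (s := fun z => z / q) (by fun_prop) hoff hz ha]
  refine Contour.winding_eq_zero_of_norm_le (hoff a ha) fun w hw => ?_
  by_contra! hlt
  rw [norm_div, div_lt_iff₀ (norm_pos_iff.2 hq), mul_comm, ← norm_mul] at hlt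
  have h1 := h w hw
  rw [Contour.Contains, Contour.winding_eq_zero_of_norm_le h1.1
    fun v hv => (hamax hv).trans hlt.le] at h1
  exact zero_ne_one h1.2

end Rational

/-! ### Iterated contour integrals -/

section Multi

open Set

/-- The product of the traces of several contours. -/
def polyTrace {k : ℕ} (γ : Fin k → Contour) : Set (Fin k → ℂ) := univ.pi fun j => (γ j).trace

/-- The point of `polyTrace γ` with parameters `t`. -/
def polyParam {k : ℕ} (γ : Fin k → Contour) (t : Fin k → ℝ) : Fin k → ℂ :=
  fun j => (γ j).param (t j)

/-- The product of the velocities, which is the density of `dz_1 ⋯ dz_k`. -/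
def polyDeriv {k : ℕ} (γ : Fin k → Contour) (t : Fin k → ℝ) : ℂ :=
  ∏ j, deriv (γ j).param (t j)

/-- Lebesgue measure on `[0,1]^k`. -/
def cubeMeasure (k : ℕ) : Measure (Fin k → ℝ) :=
  Measure.pi fun _ => volume.restrict (Ioc (0 : ℝ) 1)

instance (k : ℕ) : SigmaFinite (cubeMeasure k) := by unfold cubeMeasure; infer_instance

/-- The integral over a product of contours, as a single integral over the cube of parameters. -/
def multiIntegral {k : ℕ} (γ : Fin k → Contour) (F : (Fin k → ℂ) → ℂ) : ℂ :=
  ∫ t, F (polyParam γ t) * polyDeriv γ t ∂(cubeMeasure k)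

variable {k : ℕ} {γ : Fin k → Contour} {F G : (Fin k → ℂ) → ℂ}

theorem polyParam_mem (γ : Fin k → Contour) (t : Fin k → ℝ) : polyParam γ t ∈ polyTrace γ :=
  fun j _ => (γ j).param_mem (t j)

theorem continuous_polyParam (γ : Fin k → Contour) : Continuous (polyParam γ) :=
  continuous_pi fun j => (γ j).continuous_param.comp (continuous_apply j)

theorem integrable_polyDeriv (γ : Fin k → Contour) :
    Integrable (polyDeriv γ) (cubeMeasure k) :=
  Integrable.fintype_prod (f := fun j => deriv (γ j).param) fun j =>
    (intervalIntegrable_iff_integrableOn_Ioc_of_le zero_le_one).1 (γ j).intervalIntegrable_deriv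

theorem integrable_multi (hF : ContinuousOn F (polyTrace γ)) :
    Integrable (fun t => F (polyParam γ t) * polyDeriv γ t) (cubeMeasure k) := by
  obtain ⟨C, hC⟩ := (isCompact_univ_pi fun j => (γ j).isCompact_trace).exists_bound_of_continuousOn
    hF
  refine (integrable_polyDeriv γ).bdd_mul (c := C) ?_ (ae_of_all _ fun t => hC _ (polyParam_mem γ t))
  exact (hF.comp_continuous (continuous_polyParam γ) (polyParam_mem γ)).aestronglyMeasurable

theorem multiIntegral_congr (h : EqOn F G (polyTrace γ)) :
    multiIntegral γ F = multiIntegral γ G := by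
  unfold multiIntegral
  congr 1
  ext t
  rw [h (polyParam_mem γ t)]

theorem multiIntegral_const_mul (c : ℂ) :
    multiIntegral γ (fun z => c * F z) = c * multiIntegral γ F := by
  simp only [multiIntegral, mul_assoc]
  exact integral_const_mul _ _

theorem multiIntegral_add (hF : ContinuousOn F (polyTrace γ))
    (hG : ContinuousOn G (polyTrace γ)) :
    multiIntegral γ (fun z => F z + G z) = multiIntegral γ F + multiIntegral γ G := by
  simp only [multiIntegral, add_mul]
  exact integral_add (integrable_multi hF) (integrable_multi hG)

theorem contourIntegral_eq_setIntegral (γ : Contour) (f : ℂ → ℂ) :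
    contourIntegral γ f = ∫ s, f (γ.param s) * deriv γ.param s ∂(volume.restrict (Ioc 0 1)) := by
  rw [contourIntegral_eq, intervalIntegral.integral_of_le zero_le_one]

theorem polyParam_insertNth (γ : Fin (k + 1) → Contour) (i : Fin (k + 1)) (s : ℝ)
    (t : Fin k → ℝ) : polyParam γ (i.insertNth s t) =
      i.insertNth ((γ i).param s) (polyParam (fun j => γ (i.succAbove j)) t) := by
  ext j
  refine Fin.succAboveCases i ?_ (fun j => ?_) j <;> simp [polyParam]

theorem polyDeriv_insertNth (γ : Fin (k + 1) → Contour) (i : Fin (k + 1)) (s : ℝ)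
    (t : Fin k → ℝ) : polyDeriv γ (i.insertNth s t) =
      deriv (γ i).param s * polyDeriv (fun j => γ (i.succAbove j)) t := by
  simp [polyDeriv, Fin.prod_univ_succAbove _ i]

theorem measurePreserving_insertNth (i : Fin (k + 1)) :
    MeasurePreserving (MeasurableEquiv.piFinSuccAbove (fun _ : Fin (k + 1) => ℝ) i).symm
      ((volume.restrict (Ioc (0 : ℝ) 1)).prod (cubeMeasure k)) (cubeMeasure (k + 1)) :=
  (measurePreserving_piFinSuccAbove (fun _ : Fin (k + 1) => volume.restrict (Ioc (0 : ℝ) 1))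
    i).symm _

theorem multi_insertNth (γ : Fin (k + 1) → Contour) (i : Fin (k + 1))
    (F : (Fin (k + 1) → ℂ) → ℂ) (p : ℝ × (Fin k → ℝ)) :
    F (polyParam γ ((MeasurableEquiv.piFinSuccAbove (fun _ : Fin (k + 1) => ℝ) i).symm p)) *
      polyDeriv γ ((MeasurableEquiv.piFinSuccAbove (fun _ : Fin (k + 1) => ℝ) i).symm p) =
    F (i.insertNth ((γ i).param p.1) (polyParam (fun j => γ (i.succAbove j)) p.2)) *
      deriv (γ i).param p.1 * polyDeriv (fun j => γ (i.succAbove j)) p.2 := by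
  have h : (MeasurableEquiv.piFinSuccAbove (fun _ : Fin (k + 1) => ℝ) i).symm p =
    i.insertNth p.1 p.2 := rfl
  rw [h, polyParam_insertNth, polyDeriv_insertNth, mul_assoc]

/-- Fubini's theorem: any one of the variables may be integrated first. -/
theorem multiIntegral_eq_inner {γ : Fin (k + 1) → Contour} {F : (Fin (k + 1) → ℂ) → ℂ}
    (hF : ContinuousOn F (polyTrace γ)) (i : Fin (k + 1)) :
    multiIntegral γ F = multiIntegral (fun j => γ (i.succAbove j)) fun z =>
      contourIntegral (γ i) fun w => F (i.insertNth w z) := by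
  have hi := ((measurePreserving_insertNth i).integrable_comp_emb
    (MeasurableEquiv.measurableEmbedding _)).2 (integrable_multi hF)
  rw [multiIntegral, ← (measurePreserving_insertNth i).integral_comp']
  simp only [Function.comp_def, multi_insertNth] at hi ⊢
  rw [integral_prod_symm _ hi, multiIntegral]
  congr 1
  ext t
  simp only
  rw [integral_mul_const, contourIntegral_eq_setIntegral]

/-- Fubini's theorem: any one of the variables may be integrated last. -/
theorem multiIntegral_eq_outer {γ : Fin (k + 1) → Contour} {F : (Fin (k + 1) → ℂ) → ℂ}
    (hF : ContinuousOn F (polyTrace γ)) (i : Fin (k + 1)) :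
    multiIntegral γ F = contourIntegral (γ i) fun w =>
      multiIntegral (fun j => γ (i.succAbove j)) fun z => F (i.insertNth w z) := by
  have hi := ((measurePreserving_insertNth i).integrable_comp_emb
    (MeasurableEquiv.measurableEmbedding _)).2 (integrable_multi hF)
  rw [multiIntegral, ← (measurePreserving_insertNth i).integral_comp']
  simp only [Function.comp_def, multi_insertNth] at hi ⊢
  rw [integral_prod _ hi, contourIntegral_eq_setIntegral]
  congr 1
  ext s
  simp only [multiIntegral]
  rw [← integral_mul_const]
  congr 1
  ext t
  ring

theorem insertNth_mem_polyTrace {γ : Fin (k + 1) → Contour} {i : Fin (k + 1)} {w : ℂ}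
    {z : Fin k → ℂ} (hw : w ∈ (γ i).trace) (hz : z ∈ polyTrace fun j => γ (i.succAbove j)) :
    i.insertNth w z ∈ polyTrace γ := by
  intro j _
  refine Fin.succAboveCases i ?_ (fun j => ?_) j
  · simpa using hw
  · simpa using hz j (mem_univ _)

theorem iteratedIntegral_eq_multiIntegral : ∀ {k : ℕ} {γ : Fin k → Contour}
    {F : (Fin k → ℂ) → ℂ}, ContinuousOn F (polyTrace γ) →
    iteratedIntegral γ F = multiIntegral γ F
  | 0, γ, F, _ => by
    have h : ∀ t : Fin 0 → ℝ, polyParam γ t = Fin.elim0 := fun t => Subsingleton.elim _ _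
    simp [iteratedIntegral, multiIntegral, polyDeriv, h, cubeMeasure, measureReal_def]
  | k + 1, γ, F, hF => by
    rw [multiIntegral_eq_outer hF 0, iteratedIntegral]
    refine contourIntegral_congr fun w hw => ?_
    simp only [Fin.insertNth_zero', Fin.succAbove_zero]
    refine iteratedIntegral_eq_multiIntegral (hF.comp (by fun_prop) fun z hz => ?_)
    have := insertNth_mem_polyTrace (γ := γ) (i := 0) hw (z := z) (by simpa using hz)
    simpa using this

/-- One contour may be exchanged if this does not change the integrals in its variable. -/
theorem multiIntegral_update (i : Fin k) (γ' : Contour) (hF : ContinuousOn F (polyTrace γ))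
    (hF' : ContinuousOn F (polyTrace (Function.update γ i γ')))
    (h : ∀ z ∈ polyTrace γ, contourIntegral (γ i) (fun w => F (Function.update z i w)) =
      contourIntegral γ' (fun w => F (Function.update z i w))) :
    multiIntegral γ F = multiIntegral (Function.update γ i γ') F := by
  cases k with
  | zero => exact i.elim0
  | succ k =>
    rw [multiIntegral_eq_inner hF i, multiIntegral_eq_inner hF' i]
    have e : (fun j => Function.update γ i γ' (i.succAbove j)) = fun j => γ (i.succAbove j) := by
      ext j; rw [Function.update_of_ne (Fin.succAbove_ne i j)]
    rw [e, Function.update_self]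
    refine multiIntegral_congr fun z hz => ?_
    obtain ⟨w₀, hw₀⟩ := (γ i).trace_nonempty
    have := h _ (insertNth_mem_polyTrace hw₀ hz)
    simpa only [Fin.update_insertNth] using this

/-- The integral of an antisymmetric function over a pair of equal contours vanishes. -/
theorem multiIntegral_eq_zero_of_antisymm {i j : Fin k} (hγ : γ i = γ j)
    (h : ∀ z ∈ polyTrace γ, F (z ∘ Equiv.swap i j) = -F z) : multiIntegral γ F = 0 := by
  have hmp := measurePreserving_piCongrLeft (α := fun _ : Fin k => ℝ)
    (fun _ => volume.restrict (Ioc (0 : ℝ) 1)) (Equiv.swap i j)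
  have h1 := hmp.integral_comp' (fun t => F (polyParam γ t) * polyDeriv γ t)
  have hσ : ∀ l, γ (Equiv.swap i j l) = γ l := by
    intro l
    rcases eq_or_ne l i with rfl | hi
    · rw [Equiv.swap_apply_left, hγ]
    · rcases eq_or_ne l j with rfl | hj
      · rw [Equiv.swap_apply_right, hγ]
      · rw [Equiv.swap_apply_of_ne_of_ne hi hj]
  have he : ∀ t : Fin k → ℝ, MeasurableEquiv.piCongrLeft (fun _ => ℝ) (Equiv.swap i j) t =
      t ∘ Equiv.swap i j := by
    intro t
    ext l
    obtain ⟨l, rfl⟩ := (Equiv.swap i j).surjective l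
    rw [MeasurableEquiv.coe_piCongrLeft, Equiv.piCongrLeft_apply_apply]
    simp
  have hp : ∀ t : Fin k → ℝ, polyParam γ (t ∘ Equiv.swap i j) =
      polyParam γ t ∘ Equiv.swap i j := by
    intro t
    ext l
    simp only [polyParam, Function.comp_apply, hσ]
  have hd : ∀ t : Fin k → ℝ, polyDeriv γ (t ∘ Equiv.swap i j) = polyDeriv γ t := by
    intro t
    rw [polyDeriv, polyDeriv, ← Equiv.prod_comp (Equiv.swap i j)]
    refine Finset.prod_congr rfl fun l _ => ?_
    simp [hσ]
  simp only [he, hp, hd, h _ (polyParam_mem γ _), neg_mul] at h1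
  rw [integral_neg] at h1
  change -multiIntegral γ F = multiIntegral γ F at h1
  exact self_eq_neg.1 h1.symm

end Multi

/-! ### The nested contour integrals -/

section Nested

open Set

/-- The interaction factor `∏_{A<B} (z_A - z_B)/(z_A - q z_B)`. -/
def cross (q : ℝ) {k : ℕ} (z : Fin k → ℂ) : ℂ :=
  ∏ A : Fin k, ∏ B ∈ Finset.Ioi A, (z A - z B) / (z A - q * z B)

/-- The one-variable factor of the integrand. -/
def single (μ ν : ℝ) (t n : ℕ) (z : ℂ) : ℂ :=
  ((1 - ν * z) / (1 - z)) ^ n * ((1 - μ * z) / (1 - ν * z)) ^ t * (1 / (z * (1 - ν * z)))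

/-- The points at which no one-variable factor has a pole. -/
def regular (ν : ℝ) : Set ℂ := {z | z ≠ 0 ∧ 1 - z ≠ 0 ∧ 1 - ν * z ≠ 0}

/-- The pairs `A < B`. -/
def pairs (k : ℕ) : Finset (Fin k × Fin k) := Finset.univ.filter fun p => p.1 < p.2

variable {q μ ν : ℝ} {k : ℕ} {γ : Fin k → Contour}

theorem integrand_eq (t : ℕ) (n : Fin k → ℕ) (z : Fin k → ℂ) :
    integrand q μ ν t n z = cross q z * ∏ j, single μ ν t (n j) (z j) := rfl

theorem cross_eq_prod_pairs (z : Fin k → ℂ) :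
    cross q z = ∏ p ∈ pairs k, (z p.1 - z p.2) / (z p.1 - q * z p.2) :=
  (Finset.prod_finset_product' (pairs k) Finset.univ (fun A => Finset.Ioi A)
    (f := fun A B => (z A - z B) / (z A - q * z B)) (by simp [pairs])).symm

theorem single_succ {z : ℂ} (t n : ℕ) :
    single μ ν t (n + 1) z = single μ ν t n z * ((1 - ν * z) / (1 - z)) := by
  simp only [single, pow_succ]; ring

/-- The one-variable factors solve the free evolution equation. -/
theorem single_evolution (hν : ν ≠ 1) {z : ℂ} (hz : z ∈ regular ν) (t n : ℕ) :
    single μ ν (t + 1) (n + 1) z = ((μ - ν) / (1 - ν) : ℝ) * single μ ν t n z +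
      (1 - (μ - ν) / (1 - ν) : ℝ) * single μ ν t (n + 1) z := by
  obtain ⟨_, h1, h2⟩ := hz
  have h3 : (1 : ℂ) - ν ≠ 0 := by
    rw [sub_ne_zero]; exact_mod_cast hν.symm
  have h4 : single μ ν (t + 1) (n + 1) z =
      single μ ν t n z * (((1 - ν * z) / (1 - z)) * ((1 - μ * z) / (1 - ν * z))) := by
    simp only [single, pow_succ]; ring
  rw [h4, single_succ]
  push_cast
  generalize single μ ν t n z = s
  field_simp
  ring

theorem continuousOn_single (t n : ℕ) : ContinuousOn (single μ ν t n) (regular ν) := by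
  unfold single
  refine ((ContinuousOn.pow (ContinuousOn.div (by fun_prop) (by fun_prop) ?_) _).mul
    (ContinuousOn.pow (ContinuousOn.div (by fun_prop) (by fun_prop) ?_) _)).mul
    (ContinuousOn.div (by fun_prop) (by fun_prop) ?_)
  · exact fun z hz => hz.2.1
  · exact fun z hz => hz.2.2
  · exact fun z hz => mul_ne_zero hz.1 hz.2.2

theorem isRatOn_single {S : Set ℂ} (h0 : (0 : ℂ) ∈ S) (hν : ν ≠ 0 → (1 / (ν : ℂ)) ∈ S) (t n : ℕ)
    (h1 : n ≠ 0 → (1 : ℂ) ∈ S) : IsRatOn S (single μ ν t n) := by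
  have hlin : IsRatOn S fun z => (1 - (ν : ℂ) * z)⁻¹ :=
    IsRatOn.inv_linear fun h => hν (by simpa using h)
  have hone : IsRatOn S fun z => ((1 - (ν : ℂ) * z) / (1 - z)) ^ n := by
    rcases eq_or_ne n 0 with rfl | hn
    · simpa using IsRatOn.const 1
    · refine IsRatOn.pow ?_ n
      have := IsRatOn.inv_linear (S := S) (c := 1) (d := 1) fun _ => by simpa using h1 hn
      simpa [div_eq_mul_inv] using (IsRatOn.linear 1 (ν : ℂ)).mul this
  have hz : IsRatOn S fun z => (z - 0)⁻¹ := IsRatOn.inv_sub_const h0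
  have := (hone.mul (((IsRatOn.linear 1 (μ : ℂ)).mul hlin).pow t)).mul (hz.mul hlin)
  convert this using 1
  ext z
  simp only [single, sub_zero, mul_inv, div_eq_mul_inv, one_mul]

theorem Nested.trace_subset_regular (h : Nested q ν γ) (j : Fin k) :
    (γ j).trace ⊆ regular ν := by
  intro z hz
  refine ⟨fun h0 => (h.excludes_zero j).1 (h0 ▸ hz), fun h1 => ?_, fun h2 => ?_⟩
  · rw [sub_eq_zero] at h1
    exact (h.contains_one j).1 (h1 ▸ hz)
  · have hν : ν ≠ 0 := by
      rintro rfl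
      simp at h2
    have hν' : (ν : ℂ) ≠ 0 := by exact_mod_cast hν
    have h3 : z = 1 / (ν : ℂ) := by field_simp; linear_combination -h2
    exact (h.excludes_inv hν j).1 (h3 ▸ hz)

theorem Nested.sub_ne_zero (h : Nested q ν γ) {A B : Fin k} (hAB : A < B) {z w : ℂ}
    (hz : z ∈ (γ A).trace) (hw : w ∈ (γ B).trace) : z - q * w ≠ 0 := fun h0 =>
  (h.contains_smul A B hAB w hw).1 (_root_.sub_eq_zero.1 h0 ▸ hz)

/-- For `q = 0` there are no nested contours as soon as `k ≥ 2`: `γ_1` would have to contain `0`. -/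
theorem Nested.q_ne_zero (h : Nested q ν γ) {A B : Fin k} (hAB : A < B) : (q : ℂ) ≠ 0 := by
  rintro hq
  obtain ⟨w, hw⟩ := (γ B).trace_nonempty
  have h1 := (h.contains_smul A B hAB w hw).2
  rw [hq, zero_mul, (h.excludes_zero A).2] at h1
  exact zero_ne_one h1

theorem continuousOn_prod_pairs {T : Set (Fin k → ℂ)} {s : Finset (Fin k × Fin k)}
    (h : ∀ z ∈ T, ∀ p ∈ s, z p.1 - q * z p.2 ≠ 0) :
    ContinuousOn (fun z : Fin k → ℂ => ∏ p ∈ s, (z p.1 - z p.2) / (z p.1 - q * z p.2)) T :=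
  continuousOn_finsetProd _ fun p hp => ContinuousOn.div (by fun_prop) (by fun_prop)
    fun z hz => h z hz p hp

theorem Nested.continuousOn_cross (h : Nested q ν γ) :
    ContinuousOn (cross q) (polyTrace γ) := by
  rw [show (cross q : (Fin k → ℂ) → ℂ) = _ from funext cross_eq_prod_pairs]
  refine continuousOn_prod_pairs fun z hz p hp => ?_
  exact h.sub_ne_zero (by simpa [pairs] using hp) (hz _ (mem_univ _)) (hz _ (mem_univ _))

theorem continuousOn_comp_apply {γ : Fin k → Contour} {g : ℂ → ℂ} {D : Set ℂ}
    (hg : ContinuousOn g D) (j : Fin k) (hD : (γ j).trace ⊆ D) :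
    ContinuousOn (fun z : Fin k → ℂ => g (z j)) (polyTrace γ) :=
  hg.comp (continuous_apply j).continuousOn fun _ hz => hD (hz j (mem_univ _))

/-- A factor of `cross` is rational in each variable. -/
theorem isRatOn_pair {S : Set ℂ} {i : Fin k} {z : Fin k → ℂ} {p : Fin k × Fin k}
    (hp : p.1 ≠ p.2) (h1 : p.1 = i → (q : ℂ) * z p.2 ∈ S)
    (h2 : p.2 = i → (q : ℂ) ≠ 0 → z p.1 / q ∈ S) :
    IsRatOn S fun w => (Function.update z i w p.1 - Function.update z i w p.2) /
      (Function.update z i w p.1 - q * Function.update z i w p.2) := by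
  by_cases hA : p.1 = i
  · have hB : p.2 ≠ i := fun h => hp (hA.trans h.symm)
    simp only [hA, Function.update_self, Function.update_of_ne hB]
    simpa only [div_eq_mul_inv] using
      (IsRatOn.sub_const (S := S) (z p.2)).mul (IsRatOn.inv_sub_const (h1 hA))
  · by_cases hB : p.2 = i
    · simp only [hB, Function.update_self, Function.update_of_ne hA]
      have := (IsRatOn.linear (S := S) (z p.1) 1).mul
        (IsRatOn.inv_linear (S := S) (c := z p.1) (d := q) (h2 hB))
      simpa [div_eq_mul_inv] using this
    · simp only [Function.update_of_ne hA, Function.update_of_ne hB]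
      exact IsRatOn.const _

/-- The nested integral `∮ ⋯ ∮ ∏_{A<B} (z_A - z_B)/(z_A - q z_B) ∏_j g_j(z_j) dz_j`. -/
def nestedIntegral (q : ℝ) (γ : Fin k → Contour) (g : Fin k → ℂ → ℂ) : ℂ :=
  multiIntegral γ fun z => cross q z * ∏ j, g j (z j)

theorem Nested.continuousOn_integrand (h : Nested q ν γ) {g : Fin k → ℂ → ℂ}
    (hg : ∀ j, ContinuousOn (g j) (regular ν)) :
    ContinuousOn (fun z => cross q z * ∏ j, g j (z j)) (polyTrace γ) :=
  h.continuousOn_cross.mul (continuousOn_finsetProd _ fun j _ =>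
    continuousOn_comp_apply (hg j) j (h.trace_subset_regular j))

theorem Nested.nestedIntegral_congr (h : Nested q ν γ) {g g' : Fin k → ℂ → ℂ}
    (hg : ∀ j, EqOn (g j) (g' j) (regular ν)) : nestedIntegral q γ g = nestedIntegral q γ g' :=
  multiIntegral_congr fun z hz => by
    rw [Finset.prod_congr rfl fun j _ => hg j (h.trace_subset_regular j (hz j (mem_univ _)))]

theorem prod_update_apply (g : Fin k → ℂ → ℂ) (i : Fin k) (f : ℂ → ℂ) (z : Fin k → ℂ) :
    ∏ j, Function.update g i f j (z j) =
      f (z i) * ∏ j ∈ Finset.univ.erase i, g j (z j) := by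
  rw [← Finset.mul_prod_erase _ _ (Finset.mem_univ i), Function.update_self]
  congr 1
  refine Finset.prod_congr rfl fun j hj => ?_
  rw [Function.update_of_ne (Finset.ne_of_mem_erase hj)]

/-- The nested integral is linear in each of its one-variable factors. -/
theorem Nested.nestedIntegral_update (h : Nested q ν γ) {g : Fin k → ℂ → ℂ}
    (hg : ∀ j, ContinuousOn (g j) (regular ν)) (i : Fin k) {f₁ f₂ : ℂ → ℂ}
    (h₁ : ContinuousOn f₁ (regular ν)) (h₂ : ContinuousOn f₂ (regular ν)) (c₁ c₂ : ℂ) :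
    nestedIntegral q γ (Function.update g i fun z => c₁ * f₁ z + c₂ * f₂ z) =
      c₁ * nestedIntegral q γ (Function.update g i f₁) +
        c₂ * nestedIntegral q γ (Function.update g i f₂) := by
  have hc : ∀ f, ContinuousOn f (regular ν) → ContinuousOn
      (fun z => cross q z * ∏ j, Function.update g i f j (z j)) (polyTrace γ) := by
    intro f hf
    refine h.continuousOn_integrand fun j => ?_
    rcases eq_or_ne j i with rfl | hj
    · rwa [Function.update_self]
    · rw [Function.update_of_ne hj]; exact hg j
  simp only [nestedIntegral]
  rw [← multiIntegral_const_mul, ← multiIntegral_const_mul,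
    ← multiIntegral_add ((hc _ h₁).const_mul _) ((hc _ h₂).const_mul _)]
  congr 1
  ext z
  simp only [prod_update_apply]
  ring

/-! ### The boundary condition -/

/-- If the innermost variable has no pole at `1`, the nested integral vanishes. -/
theorem Nested.nestedIntegral_eq_zero (h : Nested q ν γ) {g : Fin k → ℂ → ℂ}
    (hg : ∀ j, ContinuousOn (g j) (regular ν)) {i : Fin k} (hi : ∀ j, j ≤ i)
    (hgi : IsRatOn {a | (γ i).Excludes a} (g i)) : nestedIntegral q γ g = 0 := by
  have hc := h.continuousOn_integrand hg
  cases k with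
  | zero => exact i.elim0
  | succ k =>
    rw [nestedIntegral, multiIntegral_eq_inner hc i]
    have h0 : ∀ z ∈ polyTrace (fun j => γ (i.succAbove j)), contourIntegral (γ i) (fun w =>
        cross q (i.insertNth w z : Fin (k + 1) → ℂ) *
          ∏ j, g j ((i.insertNth w z : Fin (k + 1) → ℂ) j)) = 0 := by
      intro z hz
      obtain ⟨w₀, hw₀⟩ := (γ i).trace_nonempty
      have hz' := insertNth_mem_polyTrace hw₀ hz
      set z' : Fin (k + 1) → ℂ := i.insertNth w₀ z with hz'_def
      have hup : ∀ w, (i.insertNth w z : Fin (k + 1) → ℂ) = Function.update z' i w := by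
        intro w; rw [hz'_def, Fin.update_insertNth]
      simp only [hup, cross_eq_prod_pairs]
      refine contourIntegral_eq_zero ((IsRatOn.prod _ fun p hp => ?_).mul
        (IsRatOn.prod _ fun j _ => ?_))
      · have hlt : p.1 < p.2 := by simpa [pairs] using hp
        refine isRatOn_pair hlt.ne (fun h1 => ?_) fun h2 hq => ?_
        · exact absurd (h1 ▸ hlt) (hi p.2).not_gt
        · exact Contour.excludes_div hq (fun w hw => h.contains_smul p.1 i (h2 ▸ hlt) w hw)
            (hz' p.1 (mem_univ _))
      · rcases eq_or_ne j i with rfl | hj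
        · simpa only [Function.update_self] using hgi
        · simp only [Function.update_of_ne hj]
          exact IsRatOn.const _
    rw [multiIntegral_congr (G := fun _ => 0 * 0) fun z hz => by simpa using h0 z hz,
      multiIntegral_const_mul, zero_mul]

theorem Nested.nestedIntegral_single_zero (h : Nested q ν γ) {g : Fin k → ℂ → ℂ}
    (hg : ∀ j, ContinuousOn (g j) (regular ν)) {i : Fin k} (hi : ∀ j, j ≤ i) {t : ℕ}
    (hgi : g i = single μ ν t 0) : nestedIntegral q γ g = 0 := by
  refine h.nestedIntegral_eq_zero hg hi ?_
  rw [hgi]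
  exact isRatOn_single (h.excludes_zero i) (fun hν => h.excludes_inv hν i) t 0
    fun h0 => absurd rfl h0

/-- The nested integrand with `single μ ν t m` in positions `i` and `j`, times
`(z_i - q z_j) / ((1 - z_i) (1 - z_j))`. -/
def cancelled (q μ ν : ℝ) (t m : ℕ) (g : Fin k → ℂ → ℂ) (i j : Fin k) (z : Fin k → ℂ) : ℂ :=
  (∏ p ∈ (pairs k).erase (i, j), (z p.1 - z p.2) / (z p.1 - q * z p.2)) * ((z i - z j) *
    ((single μ ν t m (z i) * (1 - z i)⁻¹) * (single μ ν t m (z j) * (1 - z j)⁻¹)) *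
    ∏ l ∈ (Finset.univ.erase i).erase j, g l (z l))

/-- The factor `z_i - q z_j` for neighbours `j = i + 1` cancels the pole of the nested integrand
between them. The rest is antisymmetric in `z_i` and `z_j`, so its integral vanishes once the two
contours have been made equal. -/
theorem Nested.multiIntegral_antisymm_eq_zero (h : Nested q ν γ) {g : Fin k → ℂ → ℂ}
    (hg : ∀ j, ContinuousOn (g j) (regular ν)) {i j : Fin k} (hij : (i : ℕ) + 1 = j) (t m : ℕ) :
    multiIntegral γ (cancelled q μ ν t m g i j) = 0 := by
  have hlt : i < j := by rw [Fin.lt_def]; omega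
  have hmem : ∀ p ∈ (pairs k).erase (i, j), p.1 < p.2 ∧ p ≠ (i, j) := fun p hp =>
    ⟨by simpa [pairs] using Finset.mem_of_mem_erase hp, Finset.ne_of_mem_erase hp⟩
  -- indices beyond `i` other than `j` lie beyond `j`
  have hnext : ∀ B : Fin k, i < B → B ≠ j → j < B := by
    intro B h1 h2
    rw [Fin.lt_def] at h1 ⊢
    have : (B : ℕ) ≠ j := fun h => h2 (Fin.ext h)
    omega
  set γ' := Function.update γ i (γ j) with hγ'
  have hγ'i : γ' i = γ j := Function.update_self _ _ _
  have hγ'l : ∀ l ≠ i, γ' l = γ l := fun l hl => Function.update_of_ne hl _ _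
  have hcont : ∀ Γ : Fin k → Contour, (∀ l, (Γ l).trace ⊆ regular ν) →
      (∀ z ∈ polyTrace Γ, ∀ p ∈ (pairs k).erase (i, j), z p.1 - q * z p.2 ≠ 0) →
      ContinuousOn (cancelled q μ ν t m g i j) (polyTrace Γ) := by
    intro Γ hreg hden
    have he : ContinuousOn (fun w => single μ ν t m w * (1 - w)⁻¹) (regular ν) :=
      (continuousOn_single t m).mul (ContinuousOn.inv₀ (by fun_prop) fun z hz => hz.2.1)
    unfold cancelled
    refine (continuousOn_prod_pairs hden).mul ((ContinuousOn.mul (by fun_prop)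
      (ContinuousOn.mul (continuousOn_comp_apply he i (hreg i))
        (continuousOn_comp_apply he j (hreg j)))).mul
      (continuousOn_finsetProd _ fun l _ => continuousOn_comp_apply (hg l) l (hreg l)))
  have hreg' : ∀ l, (γ' l).trace ⊆ regular ν := by
    intro l
    rcases eq_or_ne l i with rfl | hl
    · rw [hγ'i]; exact h.trace_subset_regular j
    · rw [hγ'l l hl]; exact h.trace_subset_regular l
  have hden' : ∀ z ∈ polyTrace γ', ∀ p ∈ (pairs k).erase (i, j), z p.1 - q * z p.2 ≠ 0 := by
    rintro z hz ⟨A, B⟩ hp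
    obtain ⟨hAB, hne⟩ := hmem _ hp
    simp only at hAB ⊢
    have hzA : z A ∈ (γ' A).trace := hz A (mem_univ _)
    have hzB : z B ∈ (γ' B).trace := hz B (mem_univ _)
    rcases eq_or_ne A i with rfl | hA
    · rw [hγ'i] at hzA
      rw [hγ'l B hAB.ne'] at hzB
      exact h.sub_ne_zero (hnext B hAB fun hB => hne (by rw [hB])) hzA hzB
    · rw [hγ'l A hA] at hzA
      rcases eq_or_ne B i with rfl | hB
      · rw [hγ'i] at hzB
        exact h.sub_ne_zero (hAB.trans hlt) hzA hzB
      · rw [hγ'l B hB] at hzB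
        exact h.sub_ne_zero hAB hzA hzB
  rw [multiIntegral_update i (γ j) (hcont γ h.trace_subset_regular fun z hz p hp =>
    h.sub_ne_zero (hmem p hp).1 (hz _ (mem_univ _)) (hz _ (mem_univ _))) (hcont γ' hreg' hden')]
  · refine multiIntegral_eq_zero_of_antisymm (i := i) (j := j) ?_ fun z _ => ?_
    · rw [Function.update_self, Function.update_of_ne hlt.ne']
    · have hσi : Equiv.swap i j i = j := Equiv.swap_apply_left i j
      have hσj : Equiv.swap i j j = i := Equiv.swap_apply_right i j
      have hσ : ∀ l, l ≠ i → l ≠ j → Equiv.swap i j l = l :=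
        fun l h1 h2 => Equiv.swap_apply_of_ne_of_ne h1 h2
      have e1 : ∏ l ∈ (Finset.univ.erase i).erase j, g l ((z ∘ Equiv.swap i j) l) =
          ∏ l ∈ (Finset.univ.erase i).erase j, g l (z l) := by
        refine Finset.prod_congr rfl fun l hl => ?_
        rw [Function.comp_apply, hσ l (Finset.ne_of_mem_erase (Finset.mem_of_mem_erase hl))
          (Finset.ne_of_mem_erase hl)]
      have hmap : ∀ p ∈ (pairs k).erase (i, j),
          (Equiv.swap i j p.1, Equiv.swap i j p.2) ∈ (pairs k).erase (i, j) := by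
        rintro ⟨A, B⟩ hp
        obtain ⟨hAB, hne⟩ := hmem _ hp
        simp only [Finset.mem_erase, pairs, Finset.mem_filter, Finset.mem_univ, true_and] at hAB ⊢
        rcases eq_or_ne A i with rfl | hA
        · have hBj : B ≠ j := fun hB => hne (by rw [hB])
          have hBA := hnext B hAB hBj
          rw [hσi, hσ B hAB.ne' hBj]
          exact ⟨fun hh => hlt.ne (Prod.ext_iff.1 hh).1.symm, hBA⟩
        · rcases eq_or_ne A j with rfl | hA'
          · rw [hσj, hσ B (hlt.trans hAB).ne' hAB.ne']
            exact ⟨fun hh => hAB.ne (Prod.ext_iff.1 hh).2.symm, hlt.trans hAB⟩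
          · rw [hσ A hA hA']
            refine ⟨fun hh => hA (Prod.ext_iff.1 hh).1, ?_⟩
            rcases eq_or_ne B i with rfl | hB
            · rw [hσi]; exact hAB.trans hlt
            · rcases eq_or_ne B j with rfl | hB'
              · rw [hσj]
                by_contra hcon
                exact absurd (hnext A (lt_of_le_of_ne (not_lt.1 hcon) hA.symm) hA')
                  hAB.not_gt
              · rw [hσ B hB hB']; exact hAB
      have e2 : ∏ p ∈ (pairs k).erase (i, j), ((z ∘ Equiv.swap i j) p.1 -
          (z ∘ Equiv.swap i j) p.2) / ((z ∘ Equiv.swap i j) p.1 - q * (z ∘ Equiv.swap i j) p.2) =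
          ∏ p ∈ (pairs k).erase (i, j), (z p.1 - z p.2) / (z p.1 - q * z p.2) :=
        Finset.prod_nbij' (fun p => (Equiv.swap i j p.1, Equiv.swap i j p.2))
          (fun p => (Equiv.swap i j p.1, Equiv.swap i j p.2)) hmap hmap (by simp) (by simp)
          (by simp)
      rw [cancelled, e1, e2, Function.comp_apply, Function.comp_apply, hσi, hσj, cancelled]
      ring
  · intro z hz
    simp only [cancelled]
    set S := {a | a ∉ (γ i).trace ∧ a ∉ (γ j).trace ∧ (γ i).winding a = (γ j).winding a} with hS
    have hcon : ∀ a, (γ i).Contains a → (γ j).Contains a → a ∈ S :=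
      fun a h1 h2 => ⟨h1.1, h2.1, h1.2.trans h2.2.symm⟩
    have hexc : ∀ a, (γ i).Excludes a → (γ j).Excludes a → a ∈ S :=
      fun a h1 h2 => ⟨h1.1, h2.1, h1.2.trans h2.2.symm⟩
    refine contourIntegral_eq_of_winding ((IsRatOn.prod _ fun p hp => ?_).mul
      ((IsRatOn.mul ?_ (IsRatOn.mul ?_ ?_)).mul (IsRatOn.prod _ fun l hl => ?_)))
    · obtain ⟨hAB, hne⟩ := hmem p hp
      refine isRatOn_pair hAB.ne (fun h1 => ?_) fun h2 hq => ?_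
      · have h3 : j < p.2 := hnext _ (h1 ▸ hAB) fun h2 => hne (Prod.ext h1 h2)
        exact hcon _ (h.contains_smul i p.2 (hlt.trans h3) _ (hz _ (mem_univ _)))
          (h.contains_smul j p.2 h3 _ (hz _ (mem_univ _)))
      · have h3 : p.1 < i := h2 ▸ hAB
        exact hexc _ (Contour.excludes_div hq (fun w hw => h.contains_smul p.1 i h3 w hw)
          (hz _ (mem_univ _))) (Contour.excludes_div hq
          (fun w hw => h.contains_smul p.1 j (h3.trans hlt) w hw) (hz _ (mem_univ _)))
    · simp only [Function.update_self, Function.update_of_ne hlt.ne']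
      exact IsRatOn.sub_const _
    · simp only [Function.update_self]
      have h1 : (1 : ℂ) ∈ S := hcon 1 (h.contains_one i) (h.contains_one j)
      refine (isRatOn_single (hexc 0 (h.excludes_zero i) (h.excludes_zero j))
        (fun hν => hexc _ (h.excludes_inv hν i) (h.excludes_inv hν j)) t m fun _ => h1).mul ?_
      simpa using IsRatOn.inv_linear (S := S) (c := 1) (d := 1) fun _ => by simpa using h1
    · simp only [Function.update_of_ne hlt.ne']
      exact IsRatOn.const _
    · simp only [Function.update_of_ne (Finset.ne_of_mem_erase (Finset.mem_of_mem_erase hl))]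
      exact IsRatOn.const _

theorem prod_update_update_apply (g : Fin k → ℂ → ℂ) {i j : Fin k} (hij : i ≠ j) (f f' : ℂ → ℂ)
    (z : Fin k → ℂ) : ∏ l, Function.update (Function.update g i f) j f' l (z l) =
      f (z i) * f' (z j) * ∏ l ∈ (Finset.univ.erase i).erase j, g l (z l) := by
  rw [prod_update_apply, ← Finset.mul_prod_erase _ _
    (Finset.mem_erase.2 ⟨hij, Finset.mem_univ i⟩), Function.update_self, Finset.erase_right_comm]
  have : ∏ l ∈ (Finset.univ.erase i).erase j, Function.update g i f l (z l) =
      ∏ l ∈ (Finset.univ.erase i).erase j, g l (z l) := by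
    refine Finset.prod_congr rfl fun l hl => ?_
    rw [Function.update_of_ne (Finset.ne_of_mem_erase (Finset.mem_of_mem_erase hl))]
  rw [this]
  ring

/-- The two-body boundary condition for the nested integrals. -/
theorem Nested.nestedIntegral_boundary (h : Nested q ν γ) {g : Fin k → ℂ → ℂ}
    (hg : ∀ j, ContinuousOn (g j) (regular ν)) {i j : Fin k} (hij : (i : ℕ) + 1 = j) (t m : ℕ) :
    (1 - q) * nestedIntegral q γ (Function.update (Function.update g i (single μ ν t (m + 1))) j
        (single μ ν t (m + 1))) +
      (q * ν - 1) * nestedIntegral q γ (Function.update (Function.update g i (single μ ν t m)) j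
        (single μ ν t (m + 1))) +
      (q - ν) * nestedIntegral q γ (Function.update (Function.update g i (single μ ν t (m + 1))) j
        (single μ ν t m)) +
      ν * (1 - q) * nestedIntegral q γ (Function.update (Function.update g i (single μ ν t m)) j
        (single μ ν t m)) = 0 := by
  have hlt : i < j := by rw [Fin.lt_def]; omega
  have hc : ∀ a b, ContinuousOn (fun z => cross q z * ∏ l, Function.update (Function.update g i
      (single μ ν t a)) j (single μ ν t b) l (z l)) (polyTrace γ) := by
    intro a b
    refine h.continuousOn_integrand fun l => ?_
    rcases eq_or_ne l j with rfl | hj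
    · rw [Function.update_self]; exact continuousOn_single _ _
    · rw [Function.update_of_ne hj]
      rcases eq_or_ne l i with rfl | hi
      · rw [Function.update_self]; exact continuousOn_single _ _
      · rw [Function.update_of_ne hi]; exact hg l
  have hz := h.multiIntegral_antisymm_eq_zero (μ := μ) hg hij t m
  have hz' := multiIntegral_const_mul (γ := γ) (F := cancelled q μ ν t m g i j) (((1 : ℂ) - ν) ^ 2)
  rw [hz, mul_zero] at hz'
  rw [← hz']
  simp only [nestedIntegral]
  rw [← multiIntegral_const_mul, ← multiIntegral_const_mul, ← multiIntegral_const_mul,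
    ← multiIntegral_const_mul, ← multiIntegral_add ((hc _ _).const_mul _) ((hc _ _).const_mul _),
    ← multiIntegral_add (((hc _ _).const_mul _).fun_add ((hc _ _).const_mul _)) ((hc _ _).const_mul _),
    ← multiIntegral_add ((((hc _ _).const_mul _).fun_add ((hc _ _).const_mul _)).fun_add
      ((hc _ _).const_mul _)) ((hc _ _).const_mul _)]
  refine multiIntegral_congr fun z hz => ?_
  have hi := (h.trace_subset_regular i (hz i (mem_univ _))).2.1
  have hj := (h.trace_subset_regular j (hz j (mem_univ _))).2.1
  have hd := h.sub_ne_zero hlt (hz i (mem_univ _)) (hz j (mem_univ _))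
  have hcr : cross q z = (z i - z j) / (z i - q * z j) * ∏ p ∈ (pairs k).erase (i, j),
      (z p.1 - z p.2) / (z p.1 - q * z p.2) := by
    rw [cross_eq_prod_pairs, Finset.mul_prod_erase (pairs k)
      (fun p => (z p.1 - z p.2) / (z p.1 - q * z p.2)) (a := (i, j)) (by simp [pairs, hlt])]
  simp only [prod_update_update_apply g hlt.ne, single_succ, hcr, cancelled]
  generalize ∏ p ∈ (pairs k).erase (i, j), (z p.1 - z p.2) / (z p.1 - q * z p.2) = R
  generalize ∏ l ∈ (Finset.univ.erase i).erase j, g l (z l) = R'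
  generalize single μ ν t m (z i) = s
  generalize single μ ν t m (z j) = s'
  generalize z i = x at *
  generalize z j = y at *
  field_simp
  ring

end Nested

/-! ### The nested integrals as functions of a list -/

section ListIntegral

open Set

variable {q μ ν : ℝ} {k : ℕ} {γ : Fin k → Contour}

/-- The prefactor `(-1)^k q^{k(k-1)/2} / (2πi)^k`. -/
def prefactor (q : ℝ) (k : ℕ) : ℂ :=
  (-1) ^ k * (q : ℂ) ^ (k * (k - 1) / 2) / (2 * Real.pi * Complex.I) ^ k

/-- The normalized nested integral with the one-variable factors in `gs`. It is set to `0` when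
the length of `gs` is not the number of contours. -/
def listIntegral (q : ℝ) (γ : Fin k → Contour) (gs : List (ℂ → ℂ)) : ℂ :=
  if gs.length = k then prefactor q k * nestedIntegral q γ fun j => gs.getD j 0 else 0

theorem getD_append_cons (a b : List (ℂ → ℂ)) (f : ℂ → ℂ) {i : Fin k} (hi : (i : ℕ) = a.length) :
    (fun j : Fin k => (a ++ f :: b).getD j 0) =
      Function.update (fun j : Fin k => (a ++ 0 :: b).getD j 0) i f := by
  ext1 j
  rcases eq_or_ne j i with rfl | hj
  · simp [hi]
  · rw [Function.update_of_ne hj]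
    have hj' : (j : ℕ) ≠ a.length := fun h => hj (Fin.ext (h.trans hi.symm))
    rcases lt_or_gt_of_ne hj' with h | h
    · rw [List.getD_append _ _ _ _ h, List.getD_append _ _ _ _ h]
    · rw [List.getD_append_right _ _ _ _ h.le, List.getD_append_right _ _ _ _ h.le]
      obtain ⟨d, hd⟩ : ∃ d, (j : ℕ) - a.length = d + 1 := ⟨(j : ℕ) - a.length - 1, by omega⟩
      rw [hd]; rfl

theorem continuousOn_getD {gs : List (ℂ → ℂ)} {D : Set ℂ} (h : ∀ g ∈ gs, ContinuousOn g D)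
    (j : ℕ) : ContinuousOn (gs.getD j 0) D := by
  rcases lt_or_ge j gs.length with hj | hj
  · rw [List.getD_eq_getElem _ _ hj]
    exact h _ (List.getElem_mem hj)
  · rw [List.getD_eq_default _ _ hj]
    exact continuousOn_const

theorem continuousOn_append_zero_cons {a b : List (ℂ → ℂ)} {D : Set ℂ}
    (ha : ∀ g ∈ a, ContinuousOn g D) (hb : ∀ g ∈ b, ContinuousOn g D) (j : ℕ) :
    ContinuousOn ((a ++ 0 :: b).getD j 0) D := by
  refine continuousOn_getD (fun g hg => ?_) j
  rcases List.mem_append.1 hg with h | h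
  · exact ha g h
  · rcases List.mem_cons.1 h with rfl | h
    · exact continuousOn_const
    · exact hb g h

theorem Nested.listIntegral_linear (h : Nested q ν γ) {a b : List (ℂ → ℂ)}
    (ha : ∀ g ∈ a, ContinuousOn g (regular ν)) (hb : ∀ g ∈ b, ContinuousOn g (regular ν))
    {f f₁ f₂ : ℂ → ℂ} (h₁ : ContinuousOn f₁ (regular ν)) (h₂ : ContinuousOn f₂ (regular ν))
    {c₁ c₂ : ℂ} (hf : ∀ z ∈ regular ν, f z = c₁ * f₁ z + c₂ * f₂ z) :
    listIntegral q γ (a ++ f :: b) =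
      c₁ * listIntegral q γ (a ++ f₁ :: b) + c₂ * listIntegral q γ (a ++ f₂ :: b) := by
  simp only [listIntegral, List.length_append, List.length_cons]
  split_ifs with hk
  · have hi : a.length < k := by omega
    have key := fun f => getD_append_cons (k := k) a b f (i := ⟨a.length, hi⟩) rfl
    rw [key f, key f₁, key f₂]
    have hg := fun j : Fin k => continuousOn_append_zero_cons ha hb j
    have := h.nestedIntegral_update hg ⟨a.length, hi⟩ h₁ h₂ c₁ c₂
    rw [h.nestedIntegral_congr (g' := Function.update (fun j : Fin k => (a ++ 0 :: b).getD j 0)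
      ⟨a.length, hi⟩ fun z => c₁ * f₁ z + c₂ * f₂ z), this]
    · ring
    · intro j
      rcases eq_or_ne j ⟨a.length, hi⟩ with rfl | hj
      · rw [Function.update_self, Function.update_self]; exact hf
      · rw [Function.update_of_ne hj, Function.update_of_ne hj]
        exact fun _ _ => rfl
  · ring

/-- The candidate `V(t, l)` for the expectation of `∏ q^{x_n(t)+n}` over the entries `n` of `l`. -/
def nestedSol (q μ ν : ℝ) (γ : Fin k → Contour) (t : ℕ) (l : List ℕ) : ℂ :=
  listIntegral q γ (l.map (single μ ν t))

theorem continuousOn_map_single (t : ℕ) (l : List ℕ) :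
    ∀ g ∈ l.map (single μ ν t), ContinuousOn g (regular ν) := by
  intro g hg
  obtain ⟨n, _, rfl⟩ := List.mem_map.1 hg
  exact continuousOn_single t n

theorem Nested.nestedSol_mem_boundary (h : Nested q ν γ) (t : ℕ) :
    nestedSol q μ ν γ t ∈ boundary q ν := by
  intro l m r
  simp only [nestedSol, listIntegral, List.map_append, List.map_cons, List.length_append,
    List.length_map, List.length_cons]
  split_ifs with hk
  · have hi : l.length < k := by omega
    have hj : l.length + 1 < k := by omega
    set a := l.map (single μ ν t) with ha
    set b := r.map (single μ ν t) with hb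
    have key : ∀ f f' : ℂ → ℂ, (fun j : Fin k => (a ++ f :: f' :: b).getD j 0) =
        Function.update (Function.update (fun j : Fin k => (a ++ 0 :: 0 :: b).getD j 0)
          ⟨l.length, hi⟩ f) ⟨l.length + 1, hj⟩ f' := by
      intro f f'
      rw [← getD_append_cons a (0 :: b) f (by simp [ha])]
      have := getD_append_cons (a ++ [f]) b f' (i := (⟨l.length + 1, hj⟩ : Fin k)) (by simp [ha])
      simpa using this
    rw [key (single μ ν t (m + 1)) (single μ ν t (m + 1)),
      key (single μ ν t m) (single μ ν t (m + 1)), key (single μ ν t (m + 1)) (single μ ν t m),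
      key (single μ ν t m) (single μ ν t m)]
    have hcont : ∀ j : Fin k, ContinuousOn ((a ++ 0 :: 0 :: b).getD j 0) (regular ν) := by
      refine fun j => continuousOn_append_zero_cons (continuousOn_map_single t l) ?_ j
      intro g hg
      rcases List.mem_cons.1 hg with rfl | hg
      · exact continuousOn_const
      · exact continuousOn_map_single t r g hg
    have := h.nestedIntegral_boundary (μ := μ) hcont (i := ⟨l.length, hi⟩)
      (j := ⟨l.length + 1, hj⟩) rfl t m
    simp only [Complex.real_smul]
    push_cast
    linear_combination prefactor q k * this
  · simp

/-- The entries of the list are advanced one after the other; the entries of `a` have already been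
dealt with. -/
theorem Nested.freeStep_listIntegral (h : Nested q ν γ) (hν : ν ≠ 1) (t : ℕ) (r : List ℕ)
    (hr : ∀ m ∈ r, 1 ≤ m) (a : List (ℂ → ℂ)) (ha : ∀ g ∈ a, ContinuousOn g (regular ν)) :
    freeStep ((μ - ν) / (1 - ν)) r (fun s => listIntegral q γ (a ++ s.map (single μ ν t))) =
      listIntegral q γ (a ++ r.map (single μ ν (t + 1))) := by
  induction r generalizing a with
  | nil => rfl
  | cons m r ih =>
    have hr' : ∀ m ∈ r, 1 ≤ m := fun x hx => hr x (List.mem_cons_of_mem _ hx)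
    obtain ⟨m, rfl⟩ : ∃ m', m = m' + 1 := ⟨m - 1, by have := hr m (by simp); omega⟩
    have hc : ∀ n, consL n (fun s => listIntegral q γ (a ++ s.map (single μ ν t))) =
        fun s => listIntegral q γ ((a ++ [single μ ν t n]) ++ s.map (single μ ν t)) := by
      intro n; ext s; simp
    have ha' : ∀ n, ∀ g ∈ a ++ [single μ ν t n], ContinuousOn g (regular ν) := by
      intro n g hg
      rcases List.mem_append.1 hg with hg | hg
      · exact ha g hg
      · rw [List.mem_singleton.1 hg]; exact continuousOn_single t n
    rw [freeStep, LinearMap.comp_apply, Nat.add_sub_cancel, LinearMap.add_apply,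
      LinearMap.smul_apply, LinearMap.smul_apply, map_add, map_smul, map_smul, hc, hc,
      ih hr' _ (ha' _), ih hr' _ (ha' _)]
    simp only [List.append_assoc, List.singleton_append, List.map_cons, Complex.real_smul]
    exact (h.listIntegral_linear ha (continuousOn_map_single (t + 1) r)
      (continuousOn_single t m) (continuousOn_single t (m + 1))
      fun z hz => single_evolution hν hz t m).symm

/-- The nested integrals solve the free evolution equation. -/
theorem Nested.freeStep_nestedSol (h : Nested q ν γ) (hν : ν ≠ 1) (t : ℕ) {l : List ℕ}
    (hl : ∀ m ∈ l, 1 ≤ m) :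
    freeStep ((μ - ν) / (1 - ν)) l (nestedSol q μ ν γ t) = nestedSol q μ ν γ (t + 1) l := by
  have := h.freeStep_listIntegral (μ := μ) hν t l hl [] (by simp)
  exact this

/-- If `n_k = 0`, the innermost integral has no pole inside its contour. -/
theorem Nested.nestedSol_append_zero (h : Nested q ν γ) (t : ℕ) (l : List ℕ) :
    nestedSol q μ ν γ t (l ++ [0]) = 0 := by
  simp only [nestedSol, listIntegral, List.length_map, List.length_append, List.length_singleton]
  split_ifs with hk
  · have hi : l.length < k := by omega
    rw [h.nestedIntegral_single_zero (i := ⟨l.length, hi⟩) (t := t) (μ := μ), mul_zero]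
    · exact fun j => continuousOn_getD (continuousOn_map_single t _) j
    · intro j
      rw [Fin.le_def]
      have := j.isLt
      simp only
      omega
    · rw [List.map_append, List.getD_append_right _ _ _ _ (by simp)]
      simp
  · rfl

/-! ### The initial data -/

theorem Nested.tail {γ : Fin (k + 1) → Contour} (h : Nested q ν γ) :
    Nested q ν fun j => γ j.succ where
  contains_one _ := h.contains_one _
  contains_smul _ _ hAB := h.contains_smul _ _ (Fin.succ_lt_succ_iff.2 hAB)
  excludes_zero _ := h.excludes_zero _
  excludes_inv hν _ := h.excludes_inv hν _

theorem cross_cons (w : ℂ) (z : Fin k → ℂ) :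
    cross q (Fin.cons w z : Fin (k + 1) → ℂ) =
      (∏ B, (w - z B) / (w - q * z B)) * cross q z := by
  rw [cross, Fin.prod_univ_succ]
  have h1 : Finset.Ioi (0 : Fin (k + 1)) = Finset.univ.map (Fin.succEmb k) := by
    ext j; refine Fin.cases ?_ (fun j => ?_) j <;> simp
  have h2 : ∀ i : Fin k, Finset.Ioi i.succ = (Finset.Ioi i).map (Fin.succEmb k) := by
    intro i
    ext j; refine Fin.cases ?_ (fun j => ?_) j <;> simp
  simp only [h1, h2, Finset.prod_map, Fin.coe_succEmb, Fin.cons_zero, Fin.cons_succ, cross]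

/-- The `z_1`-integral at time zero is the residue at `0`: it is the only pole outside `γ_1`, and
the integrand decays at infinity. -/
theorem Nested.contourIntegral_single_zero {γ : Fin (k + 1) → Contour} (h : Nested q ν γ) (n : ℕ)
    {z : Fin k → ℂ} (hz : z ∈ polyTrace fun j => γ j.succ) :
    contourIntegral (γ 0) (fun w => (∏ B, (w - z B) / (w - q * z B)) * single μ ν 0 (n + 1) w) =
      -(2 * Real.pi * Complex.I) * ((q : ℂ) ^ k)⁻¹ := by
  set P : Polynomial ℂ := Polynomial.C ((-1) ^ (n + 1)) *
    (∏ B, (Polynomial.X - Polynomial.C (z B))) *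
      (1 - Polynomial.C (ν : ℂ) * Polynomial.X) ^ n with hP
  set L : Multiset ℂ := Finset.univ.val.map (fun B => (q : ℂ) * z B) +
    Multiset.replicate (n + 1) 1 with hL
  have hLp : ∀ w, linProd L w = (∏ B, (w - q * z B)) * (w - 1) ^ (n + 1) := by
    intro w
    rw [hL, linProd_add, linProd, linProd, Multiset.map_map, Multiset.map_replicate,
      Multiset.prod_replicate]
    rfl
  have hPev : ∀ w, P.eval w = (-1) ^ (n + 1) * (∏ B, (w - z B)) * (1 - ν * w) ^ n := by
    intro w
    simp [hP, Polynomial.eval_prod]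
  have hmem : ∀ a ∈ L, (γ 0).Contains a := by
    intro a ha
    rcases Multiset.mem_add.1 ha with ha | ha
    · obtain ⟨B, _, rfl⟩ := Multiset.mem_map.1 ha
      exact h.contains_smul 0 B.succ (Fin.succ_pos B) _ (hz B (mem_univ _))
    · rw [Multiset.eq_of_mem_replicate ha]
      exact h.contains_one 0
  have hdeg : P.degree < L.card := by
    have hcard : L.card = k + (n + 1) := by simp [hL, add_assoc]
    rw [hcard]
    have h1 : (∏ B, (Polynomial.X - Polynomial.C (z B))).degree ≤ ((k : ℕ) : WithBot ℕ) := by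
      rw [Polynomial.degree_prod]
      simp
    have h2 : ((1 - Polynomial.C (ν : ℂ) * Polynomial.X) ^ n).degree ≤ ((n : ℕ) : WithBot ℕ) := by
      refine (Polynomial.degree_pow_le_of_le n (a := 1) ?_).trans (by simp)
      compute_degree
    have h3 : (Polynomial.C ((-1 : ℂ) ^ (n + 1))).degree ≤ ((0 : ℕ) : WithBot ℕ) := Polynomial.degree_C_le
    have h4 := Polynomial.degree_mul_le_of_le (Polynomial.degree_mul_le_of_le h3 h1) h2
    refine lt_of_le_of_lt h4 ?_
    exact_mod_cast (by omega : 0 + k + n < k + (n + 1))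
  rw [← contourIntegral_congr (f := fun w => P.eval w / linProd L w * (1 / w)),
    contourIntegral_div_mul_linProd hmem (h.excludes_zero 0) hdeg, hPev, hLp]
  · congr 1
    have hz0 : ∀ B, z B ≠ 0 := fun B => (h.trace_subset_regular B.succ (hz B (mem_univ _))).1
    have hq : ∏ B, (0 - (q : ℂ) * z B) = q ^ k * ∏ B, (0 - z B) := by
      rw [Finset.prod_congr rfl fun B _ => show 0 - (q : ℂ) * z B = q * (0 - z B) by ring,
        Finset.prod_mul_distrib]
      simp
    have hne : ∏ B, (0 - z B) ≠ 0 := Finset.prod_ne_zero_iff.2 fun B _ => by simpa using hz0 B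
    rw [hq]
    have h1 : ((-1 : ℂ)) ^ (n + 1) ≠ 0 := by simp
    simp only [mul_zero, sub_zero, one_pow, mul_one, zero_sub] at hne ⊢
    rw [mul_comm ((-1 : ℂ) ^ (n + 1)), mul_div_mul_right _ _ h1, mul_comm ((q : ℂ) ^ k),
      ← div_div, div_self hne, one_div]
  · intro w hw
    obtain ⟨hw0, hw1, hwν⟩ := h.trace_subset_regular 0 hw
    have h3 : w - 1 = -1 * (1 - w) := by ring
    simp only [hPev, hLp, single, pow_zero, mul_one, Finset.prod_div_distrib, h3, mul_pow]
    have h1 : ((-1 : ℂ)) ^ (n + 1) ≠ 0 := by simp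
    rw [div_pow, pow_succ (1 - (ν : ℂ) * w)]
    generalize (∏ B, (w - q * z B)) = D
    generalize (∏ B, (w - z B)) = E
    field_simp

theorem prefactor_succ (hq : k ≠ 0 → (q : ℂ) ≠ 0) :
    prefactor q (k + 1) * (-(2 * Real.pi * Complex.I) * ((q : ℂ) ^ k)⁻¹) = prefactor q k := by
  have hpi : (2 * Real.pi * Complex.I : ℂ) ≠ 0 := Complex.two_pi_I_ne_zero
  have hqk : (q : ℂ) ^ k ≠ 0 := by
    rcases eq_or_ne k 0 with rfl | hk
    · simp
    · exact pow_ne_zero _ (hq hk)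
  rw [prefactor, prefactor, Nat.triangle_succ, pow_add]
  field_simp
  ring

/-- Step initial data: all observables are equal to `1`. -/
theorem Nested.nestedSol_initial (μ : ℝ) : ∀ {k : ℕ} {γ : Fin k → Contour}, Nested q ν γ →
    ∀ l : List ℕ, l.length = k → (∀ m ∈ l, 1 ≤ m) → nestedSol q μ ν γ 0 l = 1
  | 0, γ, h, l, hl, _ => by
    rw [List.length_eq_zero_iff.1 hl]
    simp [nestedSol, listIntegral, prefactor, nestedIntegral, multiIntegral, polyDeriv, cubeMeasure,
      measureReal_def, cross]
  | k + 1, γ, h, [], hl, _ => by simp at hl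
  | k + 1, γ, h, m :: l, hl, hm => by
    have hl' : l.length = k := by simpa using hl
    have ih := Nested.nestedSol_initial μ h.tail l hl' fun x hx =>
      hm x (List.mem_cons_of_mem _ hx)
    obtain ⟨m, rfl⟩ : ∃ m', m = m' + 1 := ⟨m - 1, by have := hm m (by simp); omega⟩
    rw [nestedSol, listIntegral, if_pos (by simpa using hl')] at ih ⊢
    rw [← ih, nestedIntegral, multiIntegral_eq_inner (h.continuousOn_integrand fun j =>
      continuousOn_getD (continuousOn_map_single 0 _) j) 0, ← prefactor_succ (k := k), mul_assoc,
      nestedIntegral]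
    · refine congrArg (prefactor q (k + 1) * ·) ?_
      rw [← multiIntegral_const_mul]
      simp only [Fin.succAbove_zero]
      refine multiIntegral_congr fun z hz => ?_
      simp only [Fin.insertNth_zero', cross_cons, Fin.prod_univ_succ, Fin.cons_zero, Fin.cons_succ]
      rw [← h.contourIntegral_single_zero (μ := μ) m hz, mul_comm (contourIntegral _ _),
        ← contourIntegral_const_mul]
      congr 1
      ext w
      simp only [List.map_cons, Fin.val_zero, List.getD_cons_zero, Fin.val_succ,
        List.getD_cons_succ]
      ring
    · intro hk
      exact h.q_ne_zero (A := 0) (B := ⟨1, by omega⟩) (by simp [Fin.lt_def])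

end ListIntegral

/-! ### Sorted lists and the Boson process -/

theorem mem_clusterList {y : ℕ → ℕ} {M m : ℕ} (h : m ∈ clusterList y M) : 1 ≤ m ∧ m ≤ M := by
  induction M with
  | zero => simp [clusterList] at h
  | succ M ih =>
    rcases List.mem_append.1 h with h | h
    · rw [List.eq_of_mem_replicate h]; omega
    · have := ih h; omega

theorem count_clusterList (y : ℕ → ℕ) (M m : ℕ) :
    (clusterList y M).count m = if 1 ≤ m ∧ m ≤ M then y m else 0 := by
  induction M with
  | zero => rw [if_neg (by omega)]; simp [clusterList]
  | succ M ih =>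
    rw [clusterList, List.count_append, ih, List.count_replicate]
    simp only [beq_iff_eq]
    split_ifs <;> first | omega | simp_all

theorem pairwise_clusterList (y : ℕ → ℕ) (M : ℕ) : (clusterList y M).Pairwise (· ≥ ·) := by
  induction M with
  | zero => simp [clusterList]
  | succ M ih =>
    refine List.pairwise_append.2 ⟨List.pairwise_replicate.2 (Or.inr le_rfl), ih, ?_⟩
    intro a ha b hb
    rw [List.eq_of_mem_replicate ha]
    exact (mem_clusterList hb).2.trans M.le_succ

theorem eq_clusterList {l : List ℕ} {M : ℕ} (hl : l.Pairwise (· ≥ ·))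
    (h : ∀ m ∈ l, 1 ≤ m ∧ m ≤ M) : l = clusterList (fun m => l.count m) M := by
  refine List.Perm.eq_of_pairwise (fun a b _ _ h1 h2 => le_antisymm h2 h1) hl
    (pairwise_clusterList _ _) (List.perm_iff_count.2 fun m => ?_)
  rw [count_clusterList]
  split_ifs with hm
  · rfl
  · exact List.count_eq_zero.2 fun hml => hm (h m hml)

theorem bosonStep_succ_apply (q μ ν : ℝ) (y : ℕ → ℕ) (M : ℕ) (V : List ℕ → ℂ) :
    bosonStep q μ ν y (M + 1) V = ∑ s ∈ Finset.range (y (M + 1) + 1),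
      hahn q μ ν (y (M + 1)) s • bosonStep q μ ν y M fun l =>
        V (List.replicate (y (M + 1) - s) (M + 1) ++ (List.replicate s M ++ l)) := by
  rw [bosonStep, LinearMap.sum_apply]
  refine Finset.sum_congr rfl fun s _ => ?_
  rw [LinearMap.smul_apply, LinearMap.comp_apply]
  congr 2
  ext l
  rw [Module.End.mul_apply, consL_pow_apply, consL_pow_apply]

/-- The Boson process started from a weakly decreasing list stays among such lists. -/
theorem bosonStep_congr {q μ ν : ℝ} {y : ℕ → ℕ} {M : ℕ} {V W : List ℕ → ℂ}
    (h : ∀ l : List ℕ, l.Pairwise (· ≥ ·) → (∀ m ∈ l, m ≤ M) →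
      l.length = (clusterList y M).length → V l = W l) :
    bosonStep q μ ν y M V = bosonStep q μ ν y M W := by
  induction M generalizing V W with
  | zero => exact h [] (by simp) (by simp) rfl
  | succ M ih =>
    rw [bosonStep_succ_apply, bosonStep_succ_apply]
    refine Finset.sum_congr rfl fun s hs => ?_
    rw [Finset.mem_range] at hs
    congr 1
    refine ih fun l hl hlM hlen => h _ ?_ ?_ ?_
    · refine List.pairwise_append.2 ⟨List.pairwise_replicate.2 (Or.inr le_rfl),
        List.pairwise_append.2 ⟨List.pairwise_replicate.2 (Or.inr le_rfl), hl, ?_⟩, ?_⟩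
      · intro a ha b hb
        rw [List.eq_of_mem_replicate ha]
        exact hlM b hb
      · intro a ha b hb
        rw [List.eq_of_mem_replicate ha]
        rcases List.mem_append.1 hb with hb | hb
        · rw [List.eq_of_mem_replicate hb]; exact M.le_succ
        · exact (hlM b hb).trans M.le_succ
    · intro m hm
      rcases List.mem_append.1 hm with hm | hm
      · exact (List.eq_of_mem_replicate hm).le
      · rcases List.mem_append.1 hm with hm | hm
        · rw [List.eq_of_mem_replicate hm]; exact M.le_succ
        · exact (hlM m hm).trans M.le_succ
    · simp only [List.length_append, List.length_replicate, clusterList, hlen]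
      omega

theorem prod_map_clusterList (h : ℕ → ℝ) (y : ℕ → ℕ) (M : ℕ) :
    ((clusterList y M).map h).prod = ∏ m ∈ Finset.range M, h (m + 1) ^ y (m + 1) := by
  induction M with
  | zero => simp [clusterList]
  | succ M ih =>
    rw [clusterList, List.map_append, List.prod_append, ih, Finset.prod_range_succ,
      List.map_replicate, List.prod_replicate, mul_comm]

theorem bosonStep_prod (q μ ν : ℝ) (h : ℕ → ℝ) (y : ℕ → ℕ) (M : ℕ) (c : ℝ) :
    bosonStep q μ ν y M (fun l => ((c * (l.map h).prod : ℝ) : ℂ)) =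
      ((c * ∏ m ∈ Finset.range M, ∑ s ∈ Finset.range (y (m + 1) + 1),
        hahn q μ ν (y (m + 1)) s * (h m ^ s * h (m + 1) ^ (y (m + 1) - s)) : ℝ) : ℂ) := by
  induction M generalizing c with
  | zero => simp [bosonStep]
  | succ M ih =>
    rw [bosonStep_succ_apply, Finset.prod_range_succ, ← mul_assoc, Finset.mul_sum,
      Complex.ofReal_sum]
    refine Finset.sum_congr rfl fun s _ => ?_
    have hV : ∀ l : List ℕ, c * ((List.replicate (y (M + 1) - s) (M + 1) ++
        (List.replicate s M ++ l)).map h).prod =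
          (c * (h M ^ s * h (M + 1) ^ (y (M + 1) - s))) * (l.map h).prod := by
      intro l
      simp only [List.map_append, List.prod_append, List.map_replicate, List.prod_replicate]
      ring
    simp only [hV]
    rw [ih, Complex.real_smul, ← Complex.ofReal_mul]
    congr 1
    ring

/-- The Boson step commutes with expectations. -/
theorem bosonStep_integral {Ω : Type*} [MeasurableSpace Ω] {P : Measure Ω} (q μ ν : ℝ)
    (y : ℕ → ℕ) (M : ℕ) {W : Ω → List ℕ → ℂ} (hW : ∀ l, Integrable (fun ω => W ω l) P) :
    Integrable (fun ω => bosonStep q μ ν y M (W ω)) P ∧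
      ∫ ω, bosonStep q μ ν y M (W ω) ∂P = bosonStep q μ ν y M fun l => ∫ ω, W ω l ∂P := by
  induction M generalizing W with
  | zero => exact ⟨hW [], rfl⟩
  | succ M ih =>
    simp only [bosonStep_succ_apply]
    have h := fun s => ih (W := fun ω l => W ω (List.replicate (y (M + 1) - s) (M + 1) ++
      (List.replicate s M ++ l))) fun l => hW _
    refine ⟨integrable_finsetSum _ fun s _ => (h s).1.fun_smul _, ?_⟩
    rw [integral_finsetSum _ fun s _ => (h s).1.fun_smul _]
    refine Finset.sum_congr rfl fun s _ => ?_
    rw [integral_smul, (h s).2]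

/-! ### One step of the particle system -/

theorem hasSum_mul_prod {α β : Type*} {f : α → ℝ} {g : β → ℝ} {a b : ℝ} (hf : HasSum f a)
    (hg : HasSum g b) : HasSum (fun p : α × β => f p.1 * g p.2) (a * b) := by
  have h1 : Summable fun x => ‖f x‖ := hf.summable.norm
  have h2 : Summable fun x => ‖g x‖ := hg.summable.norm
  exact hf.mul hg (summable_mul_of_summable_norm h1 h2)

theorem hasSum_pi_prod {N : ℕ} {f : Fin N → ℕ → ℝ} {s : Fin N → ℝ}
    (h : ∀ i, HasSum (f i) (s i)) :
    HasSum (fun j : Fin N → ℕ => ∏ i, f i (j i)) (∏ i, s i) := by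
  induction N with
  | zero =>
    simp
  | succ N ih =>
    have h1 := ih (f := fun i => f i.succ) (s := fun i => s i.succ) fun i => h i.succ
    have h2 := hasSum_mul_prod (h 0) h1
    rw [Fin.prod_univ_succ, ← (Fin.consEquiv fun _ : Fin (N + 1) => ℕ).hasSum_iff]
    have h3 : (fun j : Fin (N + 1) → ℕ => ∏ i, f i (j i)) ∘ (Fin.consEquiv fun _ => ℕ) =
        fun p : ℕ × (Fin N → ℕ) => f 0 p.1 * ∏ i : Fin N, f i.succ (p.2 i) := by
      ext p
      simp [Fin.prod_univ_succ, Fin.consEquiv]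
    rw [h3]
    exact h2

/-- The bounded version of the observable `q^{x_n+n}`: the exponent is truncated at `0`. It
vanishes for `n = 0`, as well as for `n > N`. -/
def heightObs (q : ℝ) {N : ℕ} (x : Config N) : ℕ → ℝ
  | 0 => 0
  | m + 1 => if h : m < N then q ^ (x.1 ⟨m, h⟩ + ((m : ℤ) + 1)).toNat else 0

theorem heightObs_succ (q : ℝ) {N : ℕ} (x : Config N) (i : Fin N) :
    heightObs q x (i + 1) = q ^ (x.1 i + ((i : ℤ) + 1)).toNat := by
  simp [heightObs]

theorem abs_heightObs_le {q : ℝ} (hq : |q| < 1) {N : ℕ} (x : Config N) (m : ℕ) :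
    |heightObs q x m| ≤ 1 := by
  cases m with
  | zero => simp [heightObs]
  | succ m =>
    rw [heightObs]
    split_ifs
    · rw [abs_pow]; exact pow_le_one₀ (abs_nonneg q) hq.le
    · simp

theorem abs_prod_heightObs_le {q : ℝ} (hq : |q| < 1) {N : ℕ} (x : Config N) (l : List ℕ) :
    |(l.map (heightObs q x)).prod| ≤ 1 := by
  induction l with
  | nil => simp
  | cons m l ih =>
    rw [List.map_cons, List.prod_cons, abs_mul]
    exact mul_le_one₀ (abs_heightObs_le hq x m) (abs_nonneg _) ih

/-- The configurations that can be reached from step initial data satisfy `x_n ≥ -n`. -/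
def Reachable {N : ℕ} (x : Config N) : Prop := ∀ i, 0 ≤ x.1 i + ((i : ℤ) + 1)

theorem le_of_transProb_ne_zero {q μ ν : ℝ} {N : ℕ} {x y : Config N}
    (h : transProb q μ ν x y ≠ 0) (i : Fin N) : x.1 i ≤ y.1 i := by
  by_contra hlt
  exact Finset.prod_ne_zero_iff.1 h i (Finset.mem_univ i) (if_neg hlt)

theorem jumpProb_of_lt (q μ ν : ℝ) {j m : ℕ} (h : m < j) : jumpProb q μ ν j (m : ℕ∞) = 0 :=
  if_neg h.not_ge

theorem gap_of_pos {N : ℕ} (x : Config N) {i j : Fin N} (h : (j : ℕ) + 1 = i) :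
    gap x i = ((x.1 j - x.1 i - 1).toNat : ℕ∞) := by
  have hj : (⟨(i : ℕ) - 1, lt_of_le_of_lt (Nat.sub_le _ _) i.isLt⟩ : Fin N) = j :=
    Fin.ext (by simp only; omega)
  rw [gap, if_neg (by omega), hj]

/-- Summation over configurations is summation over jumps: the jumps that would break the order
of the particles have probability zero. -/
theorem tsum_transProb_mul (q μ ν : ℝ) {N : ℕ} (x : Config N) (g : (Fin N → ℤ) → ℝ) :
    ∑' y : Config N, transProb q μ ν x y * g y.1 =
      ∑' j : Fin N → ℕ, (∏ i, jumpProb q μ ν (j i) (gap x i)) * g fun i => x.1 i + j i := by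
  have hanti : ∀ j : Fin N → ℕ, ∏ i, jumpProb q μ ν (j i) (gap x i) ≠ 0 →
      StrictAnti fun i => x.1 i + (j i : ℤ) := by
    intro j hj a b hab
    rw [Fin.lt_def] at hab
    obtain ⟨b', hb'⟩ : ∃ b' : Fin N, (b' : ℕ) + 1 = b :=
      ⟨⟨(b : ℕ) - 1, by omega⟩, by simp only; omega⟩
    have h1 : x.1 b < x.1 b' := x.2 (by rw [Fin.lt_def]; omega)
    have h2 : x.1 b' ≤ x.1 a := x.2.antitone (by rw [Fin.le_def]; omega)
    have h3 : j b ≤ (x.1 b' - x.1 b - 1).toNat := by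
      by_contra hlt
      refine Finset.prod_ne_zero_iff.1 hj b (Finset.mem_univ b) ?_
      rw [gap_of_pos x hb']
      exact jumpProb_of_lt q μ ν (not_le.1 hlt)
    simp only
    omega
  symm
  refine (tsum_eq_tsum_of_ne_zero_bij (fun j => ⟨fun i => x.1 i + (j.1 i : ℤ),
    hanti j.1 (left_ne_zero_of_mul j.2)⟩) ?_ ?_ ?_).symm
  · intro j j' h
    ext i
    have := congrFun (congrArg Subtype.val h) i
    simpa using this
  · intro y hy
    have hle := le_of_transProb_ne_zero (left_ne_zero_of_mul hy)
    have hj : ∀ i, x.1 i + (((y.1 i - x.1 i).toNat : ℕ) : ℤ) = y.1 i := by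
      intro i
      have := hle i
      omega
    have heq : transProb q μ ν x y = ∏ i, jumpProb q μ ν (y.1 i - x.1 i).toNat (gap x i) :=
      Finset.prod_congr rfl fun i _ => if_pos (hle i)
    refine ⟨⟨fun i => (y.1 i - x.1 i).toNat, ?_⟩, Subtype.ext (funext hj)⟩
    rw [Function.mem_support] at hy ⊢
    simp only [hj]
    rwa [← heq]
  · intro j
    congr 1
    refine Finset.prod_congr rfl fun i _ => ?_
    simp

/-- One step of the particle system acts on the product observables as one step of the Boson
process. -/
theorem tsum_transProb_heightObs {q μ ν : ℝ} (hq : |q| < 1) (hμ : |μ| < 1) (hν : |ν| < 1)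
    (h0 : μ = 0 → ν = 0) {N : ℕ} {x : Config N} (hx : Reachable x) (c : ℕ → ℕ) :
    ((∑' y : Config N, transProb q μ ν x y * ((clusterList c N).map (heightObs q y)).prod : ℝ) :
      ℂ) = bosonStep q μ ν c N fun l => (((l.map (heightObs q x)).prod : ℝ) : ℂ) := by
  have hb := bosonStep_prod q μ ν (heightObs q x) c N 1
  simp only [one_mul] at hb
  rw [hb]
  congr 1
  have h1 : ∀ y : Config N, ((clusterList c N).map (heightObs q y)).prod =
      ∏ i : Fin N, (q ^ (y.1 i + ((i : ℤ) + 1)).toNat) ^ c (i + 1) := by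
    intro y
    rw [prod_map_clusterList, Finset.prod_range]
    exact Finset.prod_congr rfl fun i _ => by rw [heightObs_succ]
  simp only [h1]
  rw [tsum_transProb_mul q μ ν x fun y => ∏ i : Fin N, (q ^ (y i + ((i : ℤ) + 1)).toNat) ^ c (i + 1),
    Finset.prod_range]
  simp only [← Finset.prod_mul_distrib]
  refine (hasSum_pi_prod (f := fun i j => jumpProb q μ ν j (gap x i) *
    (q ^ (x.1 i + (j : ℤ) + ((i : ℤ) + 1)).toNat) ^ c (i + 1)) fun i => ?_).tsum_eq
  set y := c (i + 1) with hy
  have hterm : ∀ j : ℕ, jumpProb q μ ν j (gap x i) *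
      (q ^ (x.1 i + (j : ℤ) + ((i : ℤ) + 1)).toNat) ^ y =
      (heightObs q x (i + 1)) ^ y * (jumpProb q μ ν j (gap x i) * q ^ (j * y)) := by
    intro j
    have h2 : (x.1 i + (j : ℤ) + ((i : ℤ) + 1)).toNat = (x.1 i + ((i : ℤ) + 1)).toNat + j := by
      have := hx i
      omega
    rw [h2, heightObs_succ]
    ring
  simp only [hterm]
  rcases Nat.eq_zero_or_pos (i : ℕ) with hi | hi
  · have hg : gap x i = ⊤ := if_pos hi
    rw [hg]
    suffices h : ∑ s ∈ Finset.range (y + 1), hahn q μ ν y s * (heightObs q x i ^ s *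
        heightObs q x (i + 1) ^ (y - s)) = heightObs q x (i + 1) ^ y * hahn q μ ν y 0 by
      rw [h]
      exact (hasSum_jumpProb_top hq hμ hν h0 y).mul_left _
    rw [Finset.sum_eq_single 0]
    · rw [hi]; simp [mul_comm]
    · intro s _ hs
      rw [hi, heightObs, zero_pow hs]
      ring
    · simp
  · obtain ⟨i', hi'⟩ : ∃ i' : Fin N, (i' : ℕ) + 1 = i :=
      ⟨⟨(i : ℕ) - 1, by omega⟩, by simp only; omega⟩
    have hlt : x.1 i < x.1 i' := x.2 (by rw [Fin.lt_def]; omega)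
    rw [gap_of_pos x hi']
    suffices h : ∑ s ∈ Finset.range (y + 1), hahn q μ ν y s * (heightObs q x i ^ s *
        heightObs q x (i + 1) ^ (y - s)) = heightObs q x (i + 1) ^ y *
          ∑ s ∈ Finset.range (y + 1),
            hahn q μ ν y s * q ^ (s * (x.1 i' - x.1 i - 1).toNat) by
      rw [h]
      exact (hasSum_jumpProb_natCast hq hν h0 _ y).mul_left _
    rw [Finset.mul_sum]
    refine Finset.sum_congr rfl fun s hs => ?_
    have hs' : s ≤ y := by rw [Finset.mem_range] at hs; omega
    have h3 : heightObs q x i =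
        heightObs q x (i + 1) * q ^ (x.1 i' - x.1 i - 1).toNat := by
      rw [← hi', heightObs_succ, hi', heightObs_succ, ← pow_add]
      congr 1
      have := hx i
      have := hx i'
      omega
    have h4 : heightObs q x (i + 1) ^ y =
        heightObs q x (i + 1) ^ (y - s) * heightObs q x (i + 1) ^ s := by
      rw [← pow_add, Nat.sub_add_cancel hs']
    rw [h3, h4]
    ring

/-! ### The Markov chain -/

section Chain

variable {q μ ν : ℝ} {N : ℕ} {Ω : Type*} [MeasurableSpace Ω] {P : Measure Ω}
  {X : ℕ → Ω → Config N}

theorem integral_comp_eq_tsum {ι : Type*} [Countable ι] [MeasurableSpace ι]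
    [MeasurableSingletonClass ι] {Y : Ω → ι} (hY : Measurable Y) {f : ι → ℂ}
    (hf : Integrable (fun ω => f (Y ω)) P) :
    ∫ ω, f (Y ω) ∂P = ∑' y, P.real {ω | Y ω = y} • f y := by
  have hfm : AEStronglyMeasurable f (P.map Y) :=
    (measurable_of_countable f).aestronglyMeasurable
  rw [← integral_map hY.aemeasurable hfm,
    integral_countable ((integrable_map_measure hfm hY.aemeasurable).2 hf)]
  congr 1
  ext y
  rw [map_measureReal_apply hY (measurableSet_singleton y)]
  rfl

theorem measureReal_eq_tsum [IsFiniteMeasure P] {ι : Type*} [Countable ι] [MeasurableSpace ι]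
    [MeasurableSingletonClass ι] {Y : Ω → ι} (hY : Measurable Y) (A : Set Ω) :
    P.real A = ∑' y, P.real ({ω | Y ω = y} ∩ A) := by
  have h := integral_comp_eq_tsum (P := P.restrict A) hY (f := fun _ => 1) (integrable_const _)
  have h1 : ∀ y, (P.restrict A).real {ω | Y ω = y} = P.real ({ω | Y ω = y} ∩ A) :=
    fun y => measureReal_restrict_apply (hY (measurableSet_singleton y))
  simp only [integral_const, h1, Complex.real_smul, mul_one, measureReal_restrict_apply_univ] at h
  exact_mod_cast h

/-- The joint law of two consecutive states. -/
theorem IsStepTASEP.joint [IsFiniteMeasure P] (hX : IsStepTASEP q μ ν N P X) (t : ℕ)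
    (x y : Config N) :
    P.real ({ω | X (t + 1) ω = y} ∩ {ω | X t ω = x}) =
      P.real {ω | X t ω = x} * transProb q μ ν x y := by
  have hY : Measurable fun ω (s : Fin t) => X s ω := measurable_pi_lambda _ fun s => hX.measurable s
  rw [measureReal_eq_tsum hY, measureReal_eq_tsum hY {ω | X t ω = x}, ← tsum_mul_right]
  congr 1
  ext a
  set b : ℕ → Config N := fun s => if h : s < t then a ⟨s, h⟩ else if s = t then x else y with hb
  have hbt : b t = x := by simp [hb]
  have hbt' : b (t + 1) = y := by simp [hb]
  have h1 : {ω | (fun s : Fin t => X s ω) = a} ∩ {ω | X t ω = x} =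
      {ω | ∀ s ≤ t, X s ω = b s} := by
    ext ω
    simp only [Set.mem_inter_iff, Set.mem_ofPred_eq, funext_iff]
    constructor
    · rintro ⟨h1, h2⟩ s hs
      rcases hs.lt_or_eq with hs | rfl
      · rw [h1 ⟨s, hs⟩]; simp [hb, hs]
      · rw [h2, hbt]
    · intro h
      refine ⟨fun s => ?_, (h t le_rfl).trans hbt⟩
      rw [h s s.2.le]; simp [hb]
  have h2 : {ω | (fun s : Fin t => X s ω) = a} ∩ ({ω | X (t + 1) ω = y} ∩ {ω | X t ω = x}) =
      {ω | ∀ s ≤ t + 1, X s ω = b s} := by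
    rw [Set.inter_left_comm, h1]
    ext ω
    simp only [Set.mem_inter_iff, Set.mem_ofPred_eq]
    constructor
    · rintro ⟨h1, h2⟩ s hs
      rcases hs.lt_or_eq with hs | rfl
      · exact h2 s (by omega)
      · rw [h1, hbt']
    · intro h
      exact ⟨(h _ le_rfl).trans hbt', fun s hs => h s (by omega)⟩
  rw [h1, h2, hX.markov, hbt, hbt']

/-- Almost surely no particle is ever to the left of where it started. -/
theorem IsStepTASEP.ae_reachable [IsFiniteMeasure P] (hX : IsStepTASEP q μ ν N P X) (t : ℕ) :
    ∀ᵐ ω ∂P, Reachable (X t ω) := by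
  induction t with
  | zero =>
    filter_upwards [hX.init] with ω h i
    rw [h, stepConfig]
    simp
  | succ t ih =>
    have h : ∀ᵐ ω ∂P, ∀ x y : Config N, transProb q μ ν x y = 0 →
        ¬(X (t + 1) ω = y ∧ X t ω = x) := by
      rw [ae_all_iff]
      refine fun x => ae_all_iff.2 fun y => ?_
      by_cases hxy : transProb q μ ν x y = 0
      · have h1 := hX.joint t x y
        rw [hxy, mul_zero, measureReal_eq_zero_iff] at h1
        filter_upwards [measure_eq_zero_iff_ae_notMem.1 h1] with ω hω _ hc
        exact hω hc
      · exact ae_of_all _ fun ω h0 => absurd h0 hxy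
    filter_upwards [ih, h] with ω h1 h2 i
    have h3 : transProb q μ ν (X t ω) (X (t + 1) ω) ≠ 0 := fun h0 => h2 _ _ h0 ⟨rfl, rfl⟩
    have := h1 i
    have := le_of_transProb_ne_zero h3 i
    omega

/-- The expected product of the observables with indices in `l`. -/
def expObs (q : ℝ) (P : Measure Ω) (X : ℕ → Ω → Config N) (t : ℕ) (l : List ℕ) : ℂ :=
  ∫ ω, ((l.map (heightObs q (X t ω))).prod : ℂ) ∂P

theorem integrable_prod_heightObs [IsFiniteMeasure P] (hq : |q| < 1) {Y : Ω → Config N}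
    (hY : Measurable Y) (l : List ℕ) :
    Integrable (fun ω => (l.map (heightObs q (Y ω))).prod) P := by
  refine Integrable.of_bound (C := 1) ?_ (ae_of_all _ fun ω => abs_prod_heightObs_le hq _ l)
  exact ((measurable_of_countable fun y : Config N =>
    (l.map (heightObs q y)).prod).comp hY).aestronglyMeasurable

/-- The expectations evolve by the Boson process. -/
theorem IsStepTASEP.expObs_succ [IsFiniteMeasure P] (hX : IsStepTASEP q μ ν N P X)
    (hq : |q| < 1) (hμ : |μ| < 1) (hν : |ν| < 1) (h0 : μ = 0 → ν = 0) (t : ℕ) (c : ℕ → ℕ) :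
    expObs q P X (t + 1) (clusterList c N) = bosonStep q μ ν c N (expObs q P X t) := by
  have hint := fun s l => (integrable_prod_heightObs (P := P) hq (hX.measurable s) l).ofReal (𝕜 := ℂ)
  obtain ⟨hi, he⟩ := bosonStep_integral q μ ν c N (P := P)
    (W := fun ω l => (((l.map (heightObs q (X t ω))).prod : ℝ) : ℂ)) (hint t)
  rw [show expObs q P X t = fun l => ∫ ω, ((l.map (heightObs q (X t ω))).prod : ℂ) ∂P from rfl,
    ← he, integral_comp_eq_tsum (hX.measurable t)
    (f := fun x => bosonStep q μ ν c N fun l => (((l.map (heightObs q x)).prod : ℝ) : ℂ)) hi]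
  have hU : ⋃ x, {ω | X t ω = x} = Set.univ := by ext ω; simp
  have hs := hasSum_integral_iUnion (μ := P) (s := fun x => {ω | X t ω = x})
    (f := fun ω => (((clusterList c N).map (heightObs q (X (t + 1) ω))).prod : ℂ))
    (fun x => hX.measurable t (measurableSet_singleton x))
    (fun x y hxy => Set.disjoint_left.2 fun ω h1 h2 => hxy (h1.symm.trans h2))
    (hint (t + 1) _).integrableOn
  rw [hU, setIntegral_univ] at hs
  rw [expObs, ← hs.tsum_eq]
  congr 1
  ext x
  rw [integral_comp_eq_tsum (hX.measurable (t + 1))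
    (f := fun y => ((((clusterList c N).map (heightObs q y)).prod : ℝ) : ℂ))
    (hint (t + 1) _).integrableOn]
  have h1 : ∀ y, (P.restrict {ω | X t ω = x}).real {ω | X (t + 1) ω = y} =
      P.real {ω | X t ω = x} * transProb q μ ν x y := fun y =>
    (measureReal_restrict_apply (hX.measurable (t + 1) (measurableSet_singleton y))).trans
      (hX.joint t x y)
  simp only [h1]
  by_cases hp : P.real {ω | X t ω = x} = 0
  · simp [hp]
  · have hx : Reachable x := by
      by_contra hx
      refine hp ((measureReal_eq_zero_iff).2 (measure_mono_null ?_ (ae_iff.1 (hX.ae_reachable t))))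
      intro ω hω
      rw [Set.mem_ofPred_eq] at hω ⊢
      rwa [hω]
    rw [← tsum_transProb_heightObs hq hμ hν h0 hx c, Complex.real_smul, ← Complex.ofReal_mul,
      ← tsum_mul_left, Complex.ofReal_tsum]
    congr 1
    ext y
    rw [Complex.real_smul, ← Complex.ofReal_mul, mul_assoc]

theorem IsStepTASEP.expObs_zero [IsProbabilityMeasure P] (hX : IsStepTASEP q μ ν N P X)
    {l : List ℕ} (hl : ∀ m ∈ l, 1 ≤ m ∧ m ≤ N) : expObs q P X 0 l = 1 := by
  have h : ∀ᵐ ω ∂P, ((l.map (heightObs q (X 0 ω))).prod : ℂ) = 1 := by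
    filter_upwards [hX.init] with ω h
    rw [h]
    have h1 : ∀ m ∈ l, heightObs q (stepConfig N) m = 1 := by
      intro m hm
      obtain ⟨i, rfl⟩ : ∃ i : Fin N, (i : ℕ) + 1 = m :=
        ⟨⟨m - 1, by have := hl m hm; omega⟩, by have := hl m hm; simp only; omega⟩
      rw [heightObs_succ]
      simp [stepConfig]
    rw [List.map_congr_left h1]
    simp
  rw [expObs, integral_congr_ae h]
  simp

/-! ### Comparison of the two solutions -/

theorem eq_append_zero {l : List ℕ} (hl : l.Pairwise (· ≥ ·)) (h : 0 ∈ l) :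
    ∃ l', l = l' ++ [0] := by
  have h1 : 0 ≥ l.getLast (List.ne_nil_of_mem h) := hl.rel_getLast h
  refine ⟨l.dropLast, ?_⟩
  conv_lhs => rw [← List.dropLast_append_getLast (List.ne_nil_of_mem h)]
  rw [Nat.le_zero.1 h1]

/-- On weakly decreasing lists the expectations and the nested integrals agree: they have the same
initial values, and for the nested integrals the free evolution, together with the boundary
condition, is the evolution by the Boson process. -/
theorem IsStepTASEP.expObs_eq [IsProbabilityMeasure P] (hX : IsStepTASEP q μ ν N P X)
    (hq : |q| < 1) (hμ : |μ| < 1) (hν : |ν| < 1) (h0 : μ = 0 → ν = 0) {k : ℕ}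
    {γ : Fin k → Contour} (hγ : Nested q ν γ) (t : ℕ) {l : List ℕ} (hl : l.Pairwise (· ≥ ·))
    (hlN : ∀ m ∈ l, m ≤ N) (hlk : l.length = k) : expObs q P X t l = nestedSol q μ ν γ t l := by
  by_cases hz : 0 ∈ l
  · obtain ⟨l, rfl⟩ := eq_append_zero hl hz
    rw [hγ.nestedSol_append_zero, expObs]
    simp [heightObs]
  have hl1 : ∀ m ∈ l, 1 ≤ m ∧ m ≤ N := fun m hm =>
    ⟨Nat.one_le_iff_ne_zero.2 fun h => hz (h ▸ hm), hlN m hm⟩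
  induction t generalizing l with
  | zero => rw [hX.expObs_zero hl1, hγ.nestedSol_initial μ l hlk fun m hm => (hl1 m hm).1]
  | succ t ih =>
    have hν1 : ν ≠ 1 := by rintro rfl; simp at hν
    rw [← hγ.freeStep_nestedSol hν1 t fun m hm => (hl1 m hm).1]
    rw [eq_clusterList hl hl1] at hlk ⊢
    rw [hX.expObs_succ hq hμ hν h0, freeStep_clusterList hq hν _ _ (hγ.nestedSol_mem_boundary t)]
    refine bosonStep_congr fun l' hl' hlN' hlk' => ?_
    by_cases hz' : 0 ∈ l'
    · obtain ⟨l', rfl⟩ := eq_append_zero hl' hz'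
      rw [hγ.nestedSol_append_zero, expObs]
      simp [heightObs]
    · exact ih hl' hlN' (hlk'.trans hlk) hz' fun m hm =>
        ⟨Nat.one_le_iff_ne_zero.2 fun h => hz' (h ▸ hm), hlN' m hm⟩

theorem prod_qObs_eq {k : ℕ} {x : Config N} (hx : Reachable x) (n : Fin k → Fin (N + 1)) :
    ∏ i, qObs q x (n i) = ((List.ofFn fun i => (n i : ℕ)).map (heightObs q x)).prod := by
  rw [List.map_ofFn, List.prod_ofFn]
  refine Finset.prod_congr rfl fun i _ => ?_
  rw [Function.comp_apply]
  refine Fin.cases rfl (fun j => ?_) (n i)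
  rw [qObs, Fin.cons_succ, Fin.val_succ, heightObs_succ, ← zpow_natCast, Int.toNat_of_nonneg (hx j)]

theorem nestedSol_ofFn {k : ℕ} {γ : Fin k → Contour} (hγ : Nested q ν γ) (t : ℕ) (n : Fin k → ℕ) :
    nestedSol q μ ν γ t (List.ofFn n) =
      prefactor q k * iteratedIntegral γ (integrand q μ ν t n) := by
  have hg : ∀ j : Fin k, ((List.ofFn n).map (single μ ν t)).getD j 0 = single μ ν t (n j) := by
    intro j
    rw [List.getD_eq_getElem _ _ (by simp)]
    simp
  have he : integrand q μ ν t n = fun z => cross q z * ∏ j, single μ ν t (n j) (z j) :=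
    funext (integrand_eq t n)
  have hc := hγ.continuousOn_integrand fun j => continuousOn_single (μ := μ) t (n j)
  rw [nestedSol, listIntegral, if_pos (by simp), he, iteratedIntegral_eq_multiIntegral hc,
    nestedIntegral]
  simp only [hg]

end Chain

end QTasep

end

theorem theorem1p6 (q μ ν : ℝ) (hq : |q| < 1) (hν : 0 ≤ ν) (hνμ : ν ≤ μ) (hμ : μ < 1)
    (N k : ℕ) (hN : 1 ≤ N) (hk : 1 ≤ k)
    {Ω : Type*} [MeasurableSpace Ω] (P : Measure Ω) [IsProbabilityMeasure P]
    (X : ℕ → Ω → QTasep.Config N) (hX : QTasep.IsStepTASEP q μ ν N P X)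
    (n : Fin k → Fin (N + 1)) (hn : Antitone n) (t : ℕ)
    (γ : Fin k → QTasep.Contour) (hγ : QTasep.Nested q ν γ) :
    Integrable (fun ω => ∏ i, QTasep.qObs q (X t ω) (n i)) P ∧
    ((∫ ω, ∏ i, QTasep.qObs q (X t ω) (n i) ∂P : ℝ) : ℂ) =
      (-1) ^ k * (q : ℂ) ^ (k * (k - 1) / 2) / (2 * Real.pi * Complex.I) ^ k *
        QTasep.iteratedIntegral γ (QTasep.integrand q μ ν t fun j => (n j : ℕ)) := by
  have hν1 : ν < 1 := hνμ.trans_lt hμ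
  have hμ' : |μ| < 1 := abs_lt.2 ⟨by linarith, hμ⟩
  have hν' : |ν| < 1 := abs_lt.2 ⟨by linarith, hν1⟩
  have h0 : μ = 0 → ν = 0 := fun h => le_antisymm (h ▸ hνμ) hν
  have hae : ∀ᵐ ω ∂P, ((List.ofFn fun i => (n i : ℕ)).map (QTasep.heightObs q (X t ω))).prod =
      ∏ i, QTasep.qObs q (X t ω) (n i) := by
    filter_upwards [hX.ae_reachable t] with ω hω
    rw [QTasep.prod_qObs_eq hω]
  have hsorted : (List.ofFn fun i => (n i : ℕ)).Pairwise (· ≥ ·) :=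
    List.pairwise_ofFn.2 fun i j hij => hn hij.le
  refine ⟨(QTasep.integrable_prod_heightObs hq (hX.measurable t) _).congr hae, ?_⟩
  rw [← integral_congr_ae hae, ← integral_complex_ofReal, ← QTasep.prefactor,
    ← QTasep.nestedSol_ofFn hγ, ← hX.expObs_eq hq hμ' hν' h0 hγ t hsorted ?_ (by simp)]
  · rfl
  · intro m hm
    obtain ⟨i, rfl⟩ := (List.mem_ofFn' _ _).1 hm
    exact Nat.lt_succ_iff.1 (n i).isLt
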